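/- For a homogeneous space $G/H$ (with $H\subseteq G$ compact Lie groups, $H$ acting on $G$ by $h\star g=gh^{-1}$), a real (resp. complex) \emph{biquotient vector bundle over the presentation $G/H$} is a vector bundle isomorphic to $G\times_H V=(G\times V)/H$ for some finite-dimensional continuous real (resp. complex) representation $V$ of $H$, where $H$ acts on $G\times V$ by $h\cdot(g,v)=(h\star g,hv)$. Let $SO(2)\subset SO(3)$ be embedded by $A\mapsto\operatorname{diag}(A,1)$ and $U(1)\subset SU(2)$ by $z\mapsto\operatorname{diag}(z,\bar z)$, and identify $SO(3)/SO(2)=S^2$ by $[A]\mapsto Ae_3$ and $SU(2)/U(1)=S^2$ by $[A]\mapsto A\sigma_3A^*$, where $\mathbb R^3$ is identified with the traceless Hermitian $2\times 2$ matrices by means of the Pauli matrices (this is the first identification composed with the double cover $SU(2)\to SO(3)$). Then, both for real and for complex vector bundles, the set of biquotient vector bundles over $S^2=SO(3)/SO(2)$ is a proper subset of the set of biquotient vector bundles over $S^2=SU(2)/U(1)$ (vector bundles over $S^2$ being taken up to isomorphism over the identity of $S^2$). More precisely, there is, up to isomorphism of unoriented bundles, exactly one real vector bundle of rank $2$ over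 $S^2$ whose Euler class, for some orientation of the bundle, is $\pm1\in H^2(S^2;\mathbb Z)\cong\mathbb Z$; this bundle is a biquotient vector bundle over $S^2=SU(2)/U(1)$, but it is not a biquotient vector bundle over $S^2=SO(3)/SO(2)$. -/

import Mathlib

open Bundle Topology

noncomputable section

namespace Biq

/-! ### Vector bundles -/

/-- A topological `𝕜`-vector bundle of constant finite rank over `B`. -/
structure VecBundle (𝕜 : Type) [NontriviallyNormedField 𝕜] (B : Type) [TopologicalSpace B] where
  rank : ℕ
  Fiber : B → Type
  [fiberAddCommGroup : ∀ x, AddCommGroup (Fiber x)]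
  [fiberModule : ∀ x, Module 𝕜 (Fiber x)]
  [fiberTopology : ∀ x, TopologicalSpace (Fiber x)]
  [totalTopology : TopologicalSpace (TotalSpace (Fin rank → 𝕜) Fiber)]
  [fiberBundle : FiberBundle (Fin rank → 𝕜) Fiber]
  [vectorBundle : VectorBundle 𝕜 (Fin rank → 𝕜) Fiber]

namespace VecBundle

attribute [instance] fiberAddCommGroup fiberModule fiberTopology totalTopology fiberBundle
  vectorBundle

variable {𝕜 : Type} [NontriviallyNormedField 𝕜] {B : Type} [TopologicalSpace B]

/-- The total space. -/
abbrev Total (E : VecBundle 𝕜 B) : Type := TotalSpace (Fin E.rank → 𝕜) E.Fiber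

/-- The point `v` of the fiber over `x`, as a point of the total space. -/
def pt (E : VecBundle 𝕜 B) (x : B) (v : E.Fiber x) : E.Total := ⟨x, v⟩

/-- Isomorphism of vector bundles over `B` (covering the identity of `B`): a fiberwise linear
homeomorphism of total spaces. -/
def IsIso (E E' : VecBundle 𝕜 B) : Prop :=
  ∃ (Φ : E.Total ≃ₜ E'.Total) (L : ∀ x, E.Fiber x →ₗ[𝕜] E'.Fiber x),
    ∀ x v, Φ (E.pt x v) = E'.pt x (L x v)

end VecBundle

/-! ### Biquotients and biquotient vector bundles -/

section Biquotient

variable (G : Type) [Group G]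

/-- The diagonal copy `{(z, z) : z ∈ Z(G)}` of the center. -/
def diagCenter : Subgroup (G × G) :=
  (Subgroup.center G).map ((MonoidHom.id G).prod (MonoidHom.id G))

instance diagCenter_normal : (diagCenter G).Normal := by
  constructor
  rintro _ ⟨z, hz, rfl⟩ ⟨a, b⟩
  refine ⟨z, hz, ?_⟩
  have hz' := Subgroup.mem_center_iff.1 hz
  ext <;> simp [hz']

/-- The two-sided action of `G × G` on `G`: `(a, b) · g = a g b⁻¹`. -/
def twoSided : G × G →* Equiv.Perm G where
  toFun p :=
    { toFun := fun g => p.1 * g * p.2⁻¹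
      invFun := fun g => p.1⁻¹ * g * p.2
      left_inv := fun g => by group
      right_inv := fun g => by group }
  map_one' := by ext g; simp
  map_mul' p q := by ext g; simp [mul_assoc]

/-- The induced action of `(G × G) / Z` on `G`. -/
def twoSidedQuot : (G × G) ⧸ diagCenter G →* Equiv.Perm G :=
  QuotientGroup.lift (diagCenter G) (twoSided G) (by
    rintro _ ⟨z, hz, rfl⟩
    have hz' := Subgroup.mem_center_iff.1 hz
    ext g
    simp [twoSided, ← hz' g])

variable (H : Type) [Group H] [TopologicalSpace G] [TopologicalSpace H]

/-- The data of a biquotient `G // H`: a continuous homomorphism `H → (G × G) / Z` such that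
the action `h ⋆ g = f₁(h) g f₂(h)⁻¹` of `H` on `G` is free. -/
structure Biquotient where
  hom : H →* (G × G) ⧸ diagCenter G
  continuous_hom : Continuous hom
  free : ∀ (h : H) (g : G), twoSidedQuot G (hom h) g = g → h = 1

variable {G H}

namespace Biquotient

/-- The action `h ⋆ g` of `H` on `G`. -/
def star (P : Biquotient G H) (h : H) (g : G) : G := twoSidedQuot G (P.hom h) g

theorem star_one (P : Biquotient G H) (g : G) : P.star 1 g = g := by
  simp [star]

theorem star_mul (P : Biquotient G H) (h k : H) (g : G) :
    P.star (h * k) g = P.star h (P.star k g) := by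
  simp [star]

/-- The orbit equivalence relation of the action of `H` on `G`. -/
def orbitSetoid (P : Biquotient G H) : Setoid G where
  r g g' := ∃ h : H, g' = P.star h g
  iseqv :=
    { refl := fun g => ⟨1, (P.star_one g).symm⟩
      symm := by
        rintro g _ ⟨h, rfl⟩
        exact ⟨h⁻¹, by rw [← P.star_mul, inv_mul_cancel, P.star_one]⟩
      trans := by
        rintro g _ _ ⟨h, rfl⟩ ⟨k, rfl⟩
        exact ⟨k * h, (P.star_mul k h g).symm⟩ }

/-- The orbit space `G // H`, with the quotient topology. -/
def Space (P : Biquotient G H) : Type := Quotient P.orbitSetoid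

instance (P : Biquotient G H) : TopologicalSpace P.Space :=
  inferInstanceAs (TopologicalSpace (Quotient P.orbitSetoid))

/-- The class `[g]` in `G // H`. -/
def proj (P : Biquotient G H) (g : G) : P.Space := Quotient.mk P.orbitSetoid g

variable {𝕜 : Type} [RCLike 𝕜] {n : ℕ}

/-- The orbit equivalence relation of the diagonal action `h · (g, v) = (h ⋆ g, ρ(h) v)` of `H` on
`G × V`, where `V = 𝕜ⁿ`. -/
def assocSetoid (P : Biquotient G H) (ρ : Representation 𝕜 H (Fin n → 𝕜)) :
    Setoid (G × (Fin n → 𝕜)) where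
  r p q := ∃ h : H, q = (P.star h p.1, ρ h p.2)
  iseqv :=
    { refl := fun p => ⟨1, by simp [P.star_one]⟩
      symm := by
        rintro p _ ⟨h, rfl⟩
        refine ⟨h⁻¹, ?_⟩
        ext1
        · simp [← P.star_mul, P.star_one]
        · simp
      trans := by
        rintro p _ _ ⟨h, rfl⟩ ⟨k, rfl⟩
        exact ⟨k * h, by simp [P.star_mul]⟩ }

/-- The space `G ×_H V` for `V = 𝕜ⁿ` with the representation `ρ`, with the quotient topology. -/
def Assoc (P : Biquotient G H) (ρ : Representation 𝕜 H (Fin n → 𝕜)) : Type :=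
  Quotient (P.assocSetoid ρ)

instance (P : Biquotient G H) (ρ : Representation 𝕜 H (Fin n → 𝕜)) :
    TopologicalSpace (P.Assoc ρ) :=
  inferInstanceAs (TopologicalSpace (Quotient (P.assocSetoid ρ)))

/-- The class `[g, v]` in `G ×_H V`. -/
def assocMk (P : Biquotient G H) (ρ : Representation 𝕜 H (Fin n → 𝕜)) (g : G) (v : Fin n → 𝕜) :
    P.Assoc ρ :=
  Quotient.mk (P.assocSetoid ρ) (g, v)

end Biquotient

/-- For a presentation `e : G // H ≃ₜ M` of `M` as a biquotient, the class of those `𝕜`-vector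
bundles over `M` that are isomorphic to `G ×_H V` for some finite-dimensional continuous
representation `V` of `H` over `𝕜`. The isomorphism is a homeomorphism of total spaces sending the
fiber over `[g]`, i.e. the vectors `[g, v]` with `v ∈ V`, linearly to the fiber over `e [g]`. -/
def biquotientBundles (𝕜 : Type) [RCLike 𝕜] {M : Type} [TopologicalSpace M]
    (P : Biquotient G H) (e : P.Space ≃ₜ M) : Set (VecBundle 𝕜 M) :=
  {E | ∃ (n : ℕ) (ρ : Representation 𝕜 H (Fin n → 𝕜)),
    Continuous (fun p : H × (Fin n → 𝕜) => ρ p.1 p.2) ∧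
    ∃ (Φ : P.Assoc ρ ≃ₜ E.Total) (L : ∀ g : G, (Fin n → 𝕜) →ₗ[𝕜] E.Fiber (e (P.proj g))),
      ∀ g v, Φ (P.assocMk ρ g v) = E.pt (e (P.proj g)) (L g v)}

/-- The homogeneous space `G / j(H)` as a biquotient, for an injective continuous homomorphism
`j : H → G`: it is given by the inclusion `h ↦ (1, j(h))`, that is, `h ⋆ g = g j(h)⁻¹`. -/
def Biquotient.homogeneous (j : H →* G) (hj : Continuous j) (hinj : Function.Injective j) :
    Biquotient G H where
  hom := (QuotientGroup.mk' (diagCenter G)).comp ((1 : H →* G).prod j)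
  continuous_hom := continuous_quotient_mk'.comp (continuous_const.prodMk hj)
  free h g hg := by
    apply hinj
    simpa [twoSidedQuot, twoSided] using hg

theorem Biquotient.homogeneous_star (j : H →* G) (hj : Continuous j)
    (hinj : Function.Injective j) (h : H) (g : G) :
    (Biquotient.homogeneous j hj hinj).star h g = g * (j h)⁻¹ := by
  simp [Biquotient.star, Biquotient.homogeneous, twoSidedQuot, twoSided]

/-- An `H`-invariant continuous surjection from a compact `G` onto a Hausdorff space whose fibers
are exactly the orbits identifies `G // H` with that space. -/
def Biquotient.homeoOfProj [CompactSpace G] {M : Type} [TopologicalSpace M] [T2Space M]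
    (P : Biquotient G H) (p : G → M) (hp : Continuous p) (hs : Function.Surjective p)
    (hf : ∀ g g', p g = p g' ↔ ∃ h : H, g' = P.star h g) : P.Space ≃ₜ M :=
  have : CompactSpace P.Space := inferInstanceAs (CompactSpace (Quotient P.orbitSetoid))
  let q : P.Space → M := Quotient.lift p (fun g g' hgg' => (hf g g').2 hgg')
  have hq : Continuous q := hp.quotient_lift _
  have hb : Function.Bijective q := by
    constructor
    · intro x y
      induction x using Quotient.inductionOn
      induction y using Quotient.inductionOn
      intro hxy
      exact Quotient.sound ((hf _ _).1 hxy)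
    · intro m
      obtain ⟨g, rfl⟩ := hs m
      exact ⟨P.proj g, rfl⟩
  Continuous.homeoOfEquivCompactToT2 (f := Equiv.ofBijective q hb) hq

theorem Biquotient.homeoOfProj_proj [CompactSpace G] {M : Type} [TopologicalSpace M] [T2Space M]
    (P : Biquotient G H) (p : G → M) (hp : Continuous p) (hs : Function.Surjective p)
    (hf : ∀ g g', p g = p g' ↔ ∃ h : H, g' = P.star h g) (g : G) :
    P.homeoOfProj p hp hs hf (P.proj g) = p g := rfl

end Biquotient

/-! ### The two presentations of the sphere -/

/-- The unit sphere `S²` in `ℝ³`. -/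
abbrev S2 : Type := Metric.sphere (0 : EuclideanSpace ℝ (Fin 3)) 1

/-- The point of `S²` with coordinates `x, y, z`. -/
def S2.mk (x y z : ℝ) (h : x ^ 2 + y ^ 2 + z ^ 2 = 1) : S2 :=
  ⟨!₂[x, y, z], by simp [EuclideanSpace.norm_eq, Fin.sum_univ_three, h]⟩

theorem S2.sq_sum (p : S2) : p.1 0 ^ 2 + p.1 1 ^ 2 + p.1 2 ^ 2 = 1 := by
  have h := p.2
  rw [mem_sphere_zero_iff_norm, EuclideanSpace.norm_eq, Real.sqrt_eq_one] at h
  simpa [Fin.sum_univ_three] using h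

theorem S2.ext' {p q : S2} (h0 : p.1 0 = q.1 0) (h1 : p.1 1 = q.1 1) (h2 : p.1 2 = q.1 2) :
    p = q := by
  apply Subtype.ext
  ext i
  fin_cases i <;> assumption

abbrev SU2 : Type := Matrix.specialUnitaryGroup (Fin 2) ℂ
abbrev SO3 : Type := Matrix.specialOrthogonalGroup (Fin 3) ℝ
abbrev SO2 : Type := Matrix.specialOrthogonalGroup (Fin 2) ℝ

theorem isCompact_specialUnitaryGroup (𝕜 : Type) [RCLike 𝕜] (n : Type) [Fintype n]
    [DecidableEq n] :
    IsCompact (Matrix.specialUnitaryGroup n 𝕜 : Set (Matrix n n 𝕜)) := by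
  have hcl : IsClosed (Matrix.specialUnitaryGroup n 𝕜 : Set (Matrix n n 𝕜)) := by
    have : (Matrix.specialUnitaryGroup n 𝕜 : Set (Matrix n n 𝕜)) =
        {A | A * star A = 1} ∩ {A | A.det = 1} := by
      ext A
      simp [Matrix.mem_specialUnitaryGroup_iff, Matrix.mem_unitaryGroup_iff]
    rw [this]
    refine (isClosed_eq ?_ continuous_const).inter (isClosed_eq ?_ continuous_const)
    · exact continuous_id.matrix_mul continuous_id.matrix_conjTranspose
    · exact continuous_id.matrix_det
  have hK : IsCompact (Set.pi Set.univ fun _ : n => Set.pi Set.univ fun _ : n =>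
      Metric.closedBall (0 : 𝕜) 1) :=
    isCompact_univ_pi fun _ => isCompact_univ_pi fun _ => isCompact_closedBall _ _
  refine hK.of_isClosed_subset hcl ?_
  intro A hA i _ j _
  simpa using entry_norm_bound_of_unitary hA.1 i j

instance : CompactSpace SU2 := isCompact_iff_compactSpace.1 (isCompact_specialUnitaryGroup ℂ _)
instance : CompactSpace SO3 := isCompact_iff_compactSpace.1 (isCompact_specialUnitaryGroup ℝ _)


/-- The embedding `U(1) → SU(2)`, `z ↦ diag(z, z̄)`. -/
def circleToSU2 : Circle →* SU2 where
  toFun z := ⟨!![(z : ℂ), 0; 0, star (z : ℂ)], by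
    have h : (z : ℂ) * (starRingEnd ℂ) z = 1 := by simp [Complex.mul_conj]
    have h' : (starRingEnd ℂ) z * (z : ℂ) = 1 := by rw [mul_comm, h]
    rw [Matrix.mem_specialUnitaryGroup_iff, Matrix.mem_unitaryGroup_iff]
    constructor
    · ext i j
      fin_cases i <;> fin_cases j <;> simp [Matrix.mul_apply, Fin.sum_univ_two, h, h']
    · simp [Matrix.det_fin_two, h]⟩
  map_one' := by
    apply Subtype.ext
    ext i j
    fin_cases i <;> fin_cases j <;> simp
  map_mul' z w := by
    apply Subtype.ext
    ext i j
    fin_cases i <;> fin_cases j <;> simp [Matrix.mul_apply]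

theorem continuous_circleToSU2 : Continuous circleToSU2 := by
  refine Continuous.subtype_mk ?_ _
  refine continuous_matrix fun i j => ?_
  fin_cases i <;> fin_cases j <;> simp <;> fun_prop

theorem circleToSU2_injective : Function.Injective circleToSU2 := by
  intro z w h
  have := congrArg (fun A : SU2 => A.1 0 0) h
  exact Subtype.ext (by simpa [circleToSU2] using this)

/-- The embedding `SO(2) → SO(3)`, `A ↦ diag(A, 1)`. -/
def SO2ToSO3 : SO2 →* SO3 where
  toFun A := ⟨!![A.1 0 0, A.1 0 1, 0; A.1 1 0, A.1 1 1, 0; 0, 0, 1], by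
    obtain ⟨h1, h2, h3⟩ := Matrix.mem_specialOrthogonalGroup_fin_two_iff.1 A.2
    rw [Matrix.mem_specialOrthogonalGroup_iff, Matrix.mem_orthogonalGroup_iff]
    constructor
    · ext i j
      fin_cases i <;> fin_cases j <;>
        simp [Matrix.mul_apply, Fin.sum_univ_three] <;> grind
    · simp [Matrix.det_fin_three]; grind⟩
  map_one' := by
    apply Subtype.ext
    ext i j
    fin_cases i <;> fin_cases j <;> simp
  map_mul' A B := by
    apply Subtype.ext
    ext i j
    fin_cases i <;> fin_cases j <;>
      simp [Matrix.mul_apply, Fin.sum_univ_two]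

theorem continuous_SO2ToSO3 : Continuous SO2ToSO3 := by
  refine Continuous.subtype_mk ?_ _
  refine continuous_matrix fun i j => ?_
  fin_cases i <;> fin_cases j <;> simp <;>
    first
    | exact continuous_const
    | exact (continuous_subtype_val.matrix_elem _ _)

theorem SO2ToSO3_injective : Function.Injective SO2ToSO3 := by
  intro A B h
  apply Subtype.ext
  ext i j
  have h' := congrArg (fun C : SO3 => C.1 i.castSucc j.castSucc) h
  fin_cases i <;> fin_cases j <;> simpa [SO2ToSO3] using h'

/-- `SU(2) / U(1)` as a biquotient. -/
def SU2modU1 : Biquotient SU2 Circle :=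
  Biquotient.homogeneous circleToSU2 continuous_circleToSU2 circleToSU2_injective

/-- `SO(3) / SO(2)` as a biquotient. -/
def SO3modSO2 : Biquotient SO3 SO2 :=
  Biquotient.homogeneous SO2ToSO3 continuous_SO2ToSO3 SO2ToSO3_injective

theorem SU2.entries (A : SU2) : A.1 0 1 = -star (A.1 1 0) ∧ A.1 1 1 = star (A.1 0 0) ∧
    (A.1 0 0).re ^ 2 + (A.1 0 0).im ^ 2 + (A.1 1 0).re ^ 2 + (A.1 1 0).im ^ 2 = 1 := by
  have h1 : star A.1 * A.1 = 1 := Matrix.mem_unitaryGroup_iff'.1 A.2.1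
  have hd : A.1.det = 1 := A.2.2
  have h2 : star A.1 = A.1.adjugate := by
    calc star A.1 = star A.1 * (A.1 * A.1.adjugate) := by rw [Matrix.mul_adjugate, hd]; simp
      _ = A.1.adjugate := by rw [← mul_assoc, h1, one_mul]
  rw [Matrix.adjugate_fin_two] at h2
  have e1 : star (A.1 1 0) = -A.1 0 1 := by simpa using congrFun (congrFun h2 0) 1
  have e0 : star (A.1 0 0) = A.1 1 1 := by simpa using congrFun (congrFun h2 0) 0
  refine ⟨by rw [e1, neg_neg], e0.symm, ?_⟩
  have h00 := congrFun (congrFun h1 0) 0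
  simp only [Matrix.mul_apply, Fin.sum_univ_two, Matrix.star_apply, Matrix.one_apply_eq] at h00
  have := congrArg Complex.re h00
  simp at this
  linarith

/-- The projection `SU(2) → S²` onto the orbit of `(0, 0, 1)` under the adjoint action: in the
Pauli basis, `A ↦ A σ₃ A*`. It is the Hopf fibration. -/
def hopf (A : SU2) : S2 :=
  S2.mk (2 * (star (A.1 0 0) * A.1 1 0).re) (2 * (star (A.1 0 0) * A.1 1 0).im)
    (Complex.normSq (A.1 0 0) - Complex.normSq (A.1 1 0)) (by
      obtain ⟨-, -, h⟩ := A.entries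
      simp [Complex.normSq_apply]
      generalize (A.1 0 0).re = a at *
      generalize (A.1 0 0).im = b at *
      generalize (A.1 1 0).re = c at *
      generalize (A.1 1 0).im = d at *
      have : (a ^ 2 + b ^ 2 + c ^ 2 + d ^ 2) ^ 2 = 1 := by rw [h]; norm_num
      linarith)

/-- The projection `SO(3) → S²`, `A ↦ A e₃`. -/
def lastColumn (A : SO3) : S2 :=
  S2.mk (A.1 0 2) (A.1 1 2) (A.1 2 2) (by
    have h := (Matrix.mem_orthogonalGroup_iff' _ _).1 A.2.1
    have h := congrFun (congrFun h 2) 2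
    simp [Matrix.mul_apply, Fin.sum_univ_three] at h
    linarith)

theorem S2.continuous_mk {X : Type} [TopologicalSpace X] {f g k : X → ℝ} (hf : Continuous f)
    (hg : Continuous g) (hk : Continuous k) (h : ∀ x, f x ^ 2 + g x ^ 2 + k x ^ 2 = 1) :
    Continuous fun x => S2.mk (f x) (g x) (k x) (h x) := by
  refine Continuous.subtype_mk ?_ _
  refine (PiLp.continuous_toLp 2 _).comp (continuous_pi fun i => ?_)
  fin_cases i <;> simpa

theorem continuous_hopf : Continuous hopf := by
  have h (i j : Fin 2) : Continuous fun A : SU2 => A.1 i j :=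
    continuous_subtype_val.matrix_elem _ _
  apply S2.continuous_mk
  · exact continuous_const.mul (Complex.continuous_re.comp ((h 0 0).star.mul (h 1 0)))
  · exact continuous_const.mul (Complex.continuous_im.comp ((h 0 0).star.mul (h 1 0)))
  · exact (Complex.continuous_normSq.comp (h 0 0)).sub (Complex.continuous_normSq.comp (h 1 0))

theorem continuous_lastColumn : Continuous lastColumn := by
  have h (i j : Fin 3) : Continuous fun A : SO3 => A.1 i j :=
    continuous_subtype_val.matrix_elem _ _
  exact S2.continuous_mk (h 0 2) (h 1 2) (h 2 2) _

theorem hopf_surjective : Function.Surjective hopf := by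
  intro p
  have hp := p.sq_sum
  suffices ∃ a b : ℂ, a.re ^ 2 + a.im ^ 2 + b.re ^ 2 + b.im ^ 2 = 1 ∧
      2 * (star a * b).re = p.1 0 ∧ 2 * (star a * b).im = p.1 1 ∧
      Complex.normSq a - Complex.normSq b = p.1 2 by
    obtain ⟨a, b, h, h0, h1, h2⟩ := this
    have hab : a * (starRingEnd ℂ) a + b * (starRingEnd ℂ) b = 1 := by
      apply Complex.ext
      · simp; linarith
      · simp; ring
    refine ⟨⟨!![a, -star b; b, star a], ?_⟩, ?_⟩
    · rw [Matrix.mem_specialUnitaryGroup_iff, Matrix.mem_unitaryGroup_iff]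
      constructor
      · ext i j
        fin_cases i <;> fin_cases j <;>
          simp [Matrix.mul_apply, Fin.sum_univ_two] <;>
          first
          | linear_combination hab
          | ring
      · simp [Matrix.det_fin_two]
        linear_combination hab
    · apply S2.ext'
      · simpa [hopf, S2.mk] using h0
      · simpa [hopf, S2.mk] using h1
      · simpa [hopf, S2.mk] using h2
  by_cases hz : p.1 2 = -1
  · refine ⟨0, 1, ?_⟩
    have : p.1 0 = 0 ∧ p.1 1 = 0 := by
      rw [hz] at hp
      constructor <;> nlinarith [sq_nonneg (p.1 0), sq_nonneg (p.1 1)]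
    simp [this, hz]
  · generalize p.1 0 = x at *
    generalize p.1 1 = y at *
    generalize p.1 2 = z at *
    have hz1 : 0 < 1 + z := by
      have : -1 ≤ z := by nlinarith [sq_nonneg x, sq_nonneg y]
      have := lt_of_le_of_ne this (Ne.symm hz)
      linarith
    obtain ⟨s, hs, hs2⟩ : ∃ s : ℝ, 0 < s ∧ 2 * s ^ 2 = 1 + z :=
      ⟨Real.sqrt ((1 + z) / 2), by positivity, by rw [Real.sq_sqrt (by positivity)]; ring⟩
    have hb : (x / (2 * s)) ^ 2 + (y / (2 * s)) ^ 2 = (1 - z) / 2 := by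
      field_simp
      nlinarith
    refine ⟨⟨s, 0⟩, ⟨x / (2 * s), y / (2 * s)⟩, ?_, ?_, ?_, ?_⟩
    · simp only
      linarith
    · simp
      field_simp
    · simp
      field_simp
    · simp only [Complex.normSq_mk]
      nlinarith

theorem hopf_eq_iff (A B : SU2) : hopf A = hopf B ↔ ∃ z : Circle, B = SU2modU1.star z A := by
  obtain ⟨a1, a2, a3⟩ := A.entries
  obtain ⟨b1, b2, b3⟩ := B.entries
  have hstar (z : Circle) : SU2modU1.star z A = A * circleToSU2 z⁻¹ := by
    rw [SU2modU1, Biquotient.homogeneous_star, map_inv]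
  constructor
  · intro h
    have e0 : 2 * (star (A.1 0 0) * A.1 1 0).re = 2 * (star (B.1 0 0) * B.1 1 0).re :=
      congrArg (fun p : S2 => p.1 0) h
    have e1 : 2 * (star (A.1 0 0) * A.1 1 0).im = 2 * (star (B.1 0 0) * B.1 1 0).im :=
      congrArg (fun p : S2 => p.1 1) h
    have e2 : Complex.normSq (A.1 0 0) - Complex.normSq (A.1 1 0) =
        Complex.normSq (B.1 0 0) - Complex.normSq (B.1 1 0) :=
      congrArg (fun p : S2 => p.1 2) h
    have e : star (A.1 0 0) * A.1 1 0 = star (B.1 0 0) * B.1 1 0 :=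
      Complex.ext (by linarith) (by linarith)
    have e' : A.1 0 0 * star (A.1 1 0) = B.1 0 0 * star (B.1 1 0) := by
      have := congrArg star e
      simpa [mul_comm] using this
    have na : star (A.1 0 0) * A.1 0 0 = star (B.1 0 0) * B.1 0 0 := by
      apply Complex.ext
      · simp [Complex.normSq_apply] at e2 ⊢; linarith
      · simp; ring
    have nb : star (A.1 1 0) * A.1 1 0 = star (B.1 1 0) * B.1 1 0 := by
      apply Complex.ext
      · simp [Complex.normSq_apply] at e2 ⊢; linarith
      · simp; ring
    have n1 : star (A.1 0 0) * A.1 0 0 + star (A.1 1 0) * A.1 1 0 = 1 := by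
      apply Complex.ext
      · simp; linarith
      · simp; ring
    have n2 : star (B.1 0 0) * B.1 0 0 + star (B.1 1 0) * B.1 1 0 = 1 := by
      rw [← na, ← nb, n1]
    obtain ⟨z, hz⟩ : ∃ z, z = star (A.1 0 0) * B.1 0 0 + star (A.1 1 0) * B.1 1 0 := ⟨_, rfl⟩
    have h00 : B.1 0 0 = A.1 0 0 * z := by
      rw [hz]
      linear_combination (-B.1 1 0) * e' - B.1 0 0 * na - B.1 0 0 * n2
    have h10 : B.1 1 0 = A.1 1 0 * z := by
      rw [hz]
      linear_combination (-B.1 0 0) * e - B.1 1 0 * nb - B.1 1 0 * n2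
    have hzz : star z * z = 1 := by
      have : (star (A.1 0 0) * A.1 0 0 + star (A.1 1 0) * A.1 1 0) * (star z * z) = 1 := by
        rw [h00, h10] at n2
        simp only [star_mul'] at n2
        linear_combination n2
      rwa [n1, one_mul] at this
    have hz1 : ‖z‖ = 1 := by
      have h' := congrArg norm hzz
      rw [norm_mul, norm_star, norm_one] at h'
      nlinarith [norm_nonneg z]
    let w : Circle := ⟨z, mem_sphere_zero_iff_norm.2 hz1⟩
    refine ⟨w⁻¹, ?_⟩
    rw [hstar, inv_inv]
    apply Subtype.ext
    ext i j
    fin_cases i <;> fin_cases j <;>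
      simp [circleToSU2, Matrix.mul_apply, Fin.sum_univ_two, w, h00, h10, a1, a2, b1, b2]
  · rintro ⟨z, rfl⟩
    rw [hstar]
    have hz : Complex.normSq (z : ℂ) = 1 := by simp
    have hz' := hz
    rw [Complex.normSq_apply] at hz'
    apply S2.ext' <;>
      simp [hopf, S2.mk, circleToSU2, Matrix.mul_apply, Fin.sum_univ_two] <;>
      grind

theorem rotation_aux (x y z : ℝ) (hz : 1 + z ≠ 0) (h : x ^ 2 + y ^ 2 + z ^ 2 = 1) :
    let A : Matrix (Fin 3) (Fin 3) ℝ := !![1 - x ^ 2 / (1 + z), -(x * y) / (1 + z), x;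
      -(x * y) / (1 + z), 1 - y ^ 2 / (1 + z), y; -x, -y, z]
    A * A.transpose = 1 ∧ A.det = 1 := by
  have h' : x ^ 2 = 1 - y ^ 2 - z ^ 2 := by linarith
  constructor
  · ext i j
    fin_cases i <;> fin_cases j <;>
      simp [Matrix.mul_apply, Fin.sum_univ_three] <;> field_simp <;> grind
  · simp [Matrix.det_fin_three]
    field_simp
    grind

theorem lastColumn_surjective : Function.Surjective lastColumn := by
  intro p
  have hp := p.sq_sum
  suffices ∃ A : Matrix (Fin 3) (Fin 3) ℝ, A * A.transpose = 1 ∧ A.det = 1 ∧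
      ∀ i, A i 2 = p.1 i by
    obtain ⟨A, h1, h2, h3⟩ := this
    refine ⟨⟨A, ?_⟩, ?_⟩
    · rw [Matrix.mem_specialOrthogonalGroup_iff, Matrix.mem_orthogonalGroup_iff]
      exact ⟨h1, h2⟩
    · apply S2.ext' <;> simp [lastColumn, S2.mk, h3]
  by_cases hz : p.1 2 = -1
  · have : p.1 0 = 0 ∧ p.1 1 = 0 := by
      rw [hz] at hp
      constructor <;> nlinarith [sq_nonneg (p.1 0), sq_nonneg (p.1 1)]
    refine ⟨!![1, 0, 0; 0, -1, 0; 0, 0, -1], ?_, ?_, ?_⟩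
    · ext i j
      fin_cases i <;> fin_cases j <;> simp [Matrix.mul_apply, Fin.sum_univ_three]
    · simp [Matrix.det_fin_three]
    · intro i
      fin_cases i <;> simp [this, hz]
  · have hz1 : 1 + p.1 2 ≠ 0 := fun h => hz (by linarith)
    obtain ⟨h1, h2⟩ := rotation_aux (p.1 0) (p.1 1) (p.1 2) hz1 hp
    refine ⟨_, h1, h2, ?_⟩
    intro i
    fin_cases i <;> simp

theorem lastColumn_eq_iff (A B : SO3) :
    lastColumn A = lastColumn B ↔ ∃ R : SO2, B = SO3modSO2.star R A := by
  have hstar (R : SO2) : SO3modSO2.star R A = A * SO2ToSO3 R⁻¹ := by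
    rw [SO3modSO2, Biquotient.homogeneous_star, map_inv]
  constructor
  · intro h
    have hc (i : Fin 3) : A.1 i 2 = B.1 i 2 := by
      have := congrArg (fun p : S2 => p.1 i) h
      fin_cases i <;> simpa [lastColumn, S2.mk] using this
    obtain ⟨C, hC⟩ : ∃ C : SO3, C = A⁻¹ * B := ⟨_, rfl⟩
    have hCv : C.1 = A.1.transpose * B.1 := by rw [hC]; rfl
    have hAA := (Matrix.mem_orthogonalGroup_iff' _ _).1 A.2.1
    have c2 (i : Fin 3) : C.1 i 2 = if i = 2 then 1 else 0 := by
      have := congrFun (congrFun hAA i) 2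
      rw [hCv, Matrix.mul_apply]
      simp only [← hc]
      rw [← Matrix.mul_apply, this, Matrix.one_apply]
    have hCC := (Matrix.mem_orthogonalGroup_iff _ _).1 C.2.1
    have hdet : C.1.det = 1 := C.2.2
    have c02 : C.1 0 2 = 0 := by simpa using c2 0
    have c12 : C.1 1 2 = 0 := by simpa using c2 1
    have c22 : C.1 2 2 = 1 := by simpa using c2 2
    have r (i j : Fin 3) : C.1 i 0 * C.1 j 0 + C.1 i 1 * C.1 j 1 + C.1 i 2 * C.1 j 2 =
        if i = j then 1 else 0 := by
      have := congrFun (congrFun hCC i) j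
      simpa [Matrix.mul_apply, Fin.sum_univ_three, Matrix.one_apply] using this
    have r22 : C.1 2 0 ^ 2 + C.1 2 1 ^ 2 = 0 := by
      have := r 2 2
      simp [c22] at this
      linarith
    have c20 : C.1 2 0 = 0 := by nlinarith [sq_nonneg (C.1 2 0), sq_nonneg (C.1 2 1)]
    have c21 : C.1 2 1 = 0 := by nlinarith [sq_nonneg (C.1 2 0), sq_nonneg (C.1 2 1)]
    have r00 : C.1 0 0 * C.1 0 0 + C.1 0 1 * C.1 0 1 = 1 := by simpa [c02] using r 0 0
    have r11 : C.1 1 0 * C.1 1 0 + C.1 1 1 * C.1 1 1 = 1 := by simpa [c12] using r 1 1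
    have r01 : C.1 0 0 * C.1 1 0 + C.1 0 1 * C.1 1 1 = 0 := by simpa [c02] using r 0 1
    have hd : C.1 0 0 * C.1 1 1 - C.1 0 1 * C.1 1 0 = 1 := by
      simpa [Matrix.det_fin_three, c02, c12, c22, c20, c21] using hdet
    let R : SO2 := ⟨!![C.1 0 0, C.1 0 1; C.1 1 0, C.1 1 1], by
      rw [Matrix.of_mem_specialOrthogonalGroup_fin_two_iff]
      refine ⟨?_, ?_, ?_⟩ <;> grind⟩
    have hR : SO2ToSO3 R = C := by
      apply Subtype.ext
      ext i j
      fin_cases i <;> fin_cases j <;>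
        simp [SO2ToSO3, R, c02, c12, c22, c20, c21]
    refine ⟨R⁻¹, ?_⟩
    rw [hstar, inv_inv, hR, hC, mul_inv_cancel_left]
  · rintro ⟨R, rfl⟩
    rw [hstar]
    apply S2.ext' <;>
      simp [lastColumn, S2.mk, SO2ToSO3, Matrix.mul_apply, Fin.sum_univ_three]

/-- The presentation `SU(2) / U(1) = S²`, `[A] ↦ A σ₃ A*`. -/
def SU2modU1.homeo : SU2modU1.Space ≃ₜ S2 :=
  SU2modU1.homeoOfProj hopf continuous_hopf hopf_surjective hopf_eq_iff

/-- The presentation `SO(3) / SO(2) = S²`, `[A] ↦ A e₃`. -/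
def SO3modSO2.homeo : SO3modSO2.Space ≃ₜ S2 :=
  SO3modSO2.homeoOfProj lastColumn continuous_lastColumn lastColumn_surjective lastColumn_eq_iff

/-! ### The Euler class of a rank-2 bundle over the sphere -/

/-- `b` is a continuous frame of `E` over the set `D`. (Its values off `D` are irrelevant.) -/
def IsFrameOn (E : VecBundle ℝ S2) (b : ∀ x, Module.Basis (Fin 2) ℝ (E.Fiber x)) (D : Set S2) :
    Prop :=
  ∀ i, ContinuousOn (fun x => E.pt x (b x i)) D

/-- `o` is an orientation of the rank-2 bundle `E`: a choice of orientations of the fibers which,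
near each point, is the one given by some continuous local frame. -/
def IsOrientation (E : VecBundle ℝ S2) (o : ∀ x, Orientation ℝ (E.Fiber x) (Fin 2)) : Prop :=
  ∀ x₀, ∃ U ∈ 𝓝 x₀, ∃ b : ∀ x, Module.Basis (Fin 2) ℝ (E.Fiber x),
    IsFrameOn E b U ∧ ∀ x ∈ U, (b x).orientation = o x

/-- The closed upper hemisphere. -/
def upper : Set S2 := {x | 0 ≤ x.1 2}

/-- The closed lower hemisphere. -/
def lower : Set S2 := {x | x.1 2 ≤ 0}

/-- The equator, run through counterclockwise as seen from the north pole; this is the boundary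
orientation of the upper hemisphere for the outward orientation of `S²`. -/
def equator (t : ℝ) : S2 := S2.mk (Real.cos t) (Real.sin t) 0 (by simp)

/-- The `2π`-periodic curve `c` in `ℂ ∖ {0}` has winding number `n` around `0` over one period. -/
def HasWindingNumber (c : ℝ → ℂ) (n : ℤ) : Prop :=
  ∃ θ : ℝ → ℂ, Continuous θ ∧ (∀ t, c t = Complex.exp (θ t)) ∧
    θ (2 * Real.pi) = θ 0 + 2 * Real.pi * n * Complex.I

/-- The Euler class of the rank-2 bundle `E` over `S²` with orientation `o`, evaluated on the
fundamental class of `S²`, is `n`. The Euler class is the primary obstruction to a nowhere zero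
section: the nowhere zero section `bL · 0` over the lower hemisphere, written along the equator in
the positive frame `bU` over the upper hemisphere, is a closed curve in `ℝ² ∖ {0} = ℂ ∖ {0}`, and
`n` is its degree. -/
def HasEulerNumber (E : VecBundle ℝ S2) (o : ∀ x, Orientation ℝ (E.Fiber x) (Fin 2)) (n : ℤ) :
    Prop :=
  ∃ bU bL : ∀ x, Module.Basis (Fin 2) ℝ (E.Fiber x),
    IsFrameOn E bU upper ∧ (∀ x ∈ upper, (bU x).orientation = o x) ∧
    IsFrameOn E bL lower ∧ (∀ x ∈ lower, (bL x).orientation = o x) ∧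
    HasWindingNumber (fun t =>
      let c := (bU (equator t)).repr (bL (equator t) 0)
      (c 0 : ℂ) + (c 1 : ℂ) * Complex.I) n

/-- `E` is a real rank-2 vector bundle over `S²` whose Euler class, for some choice of orientation
of `E`, is a generator of `H²(S²; ℤ) = ℤ`. (Reversing the orientation of `E` changes the sign.) -/
def HasEulerClassPMOne (E : VecBundle ℝ S2) : Prop :=
  E.rank = 2 ∧ ∃ o, IsOrientation E o ∧ (HasEulerNumber E o 1 ∨ HasEulerNumber E o (-1))

end Biq
end

/-! A bundle that comes from a presentation `G // H` pulls back to a trivial bundle on `G`, by a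
frame equivariant for a representation of `H`; for compact `G` and Hausdorff base the converse holds
too (`exists_frame_of_mem_biquotientBundles`, `mem_biquotientBundles_of_frame`). Everything is done
with such frames.

The inclusion of the two classes follows by composing frame and representation with the double
covers `SU(2) → SO(3)` and `U(1) → SO(2)`, which are compatible with the projections to the sphere.

For strictness, take the Hopf line bundle, whose Euler class generates `H²(S²; ℤ)`. On `SU(2) = S³`
it becomes trivial, and an explicit nowhere zero section transforms under `U(1)` by a character
(`line_mem_biquotientBundles`). On `SO(3)` it does not: `H²(SO(3); ℤ) = ℤ/2`, and the pullback of
the generator is the nonzero class. In elementary terms (`no_clutched_section`), the loop over the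
equator contracts through the upper hemisphere to the fibre circle and through the lower one to the
reversed fibre circle. The winding of a section along these loops would have to differ by one
because of the clutching function, yet it differs by twice an integer.

All of this uses only the description by the clutching function `planar` (`IsClutched`), which
determines the bundle. A bundle with Euler number `±1` has this form: its transition map on the
equator takes values in `GL₂⁺(ℝ)`, is deformed to a complex multiplication, and its winding number
is that of `planar`, after conjugation when the sign is negative. Hence uniqueness. The model fibre
`ℂ` is regarded as a vector space over `𝕜`, so the real and the complex case share one argument. -/

noncomputable section

namespace Biq

/-! ### Frames and sections of vector bundles -/

namespace VecBundle

variable {𝕜 : Type} [RCLike 𝕜] {B : Type} [TopologicalSpace B] {X : Type*} [TopologicalSpace X]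
  {W : Type*} [NormedAddCommGroup W] [NormedSpace 𝕜 W]

/-- The coordinates, with respect to the preferred trivialization at `b₀`, of vectors in the fiber
over `b`. -/
def coord (E : VecBundle 𝕜 B) (b₀ b : B) : E.Fiber b →ₗ[𝕜] (Fin E.rank → 𝕜) :=
  (trivializationAt (Fin E.rank → 𝕜) E.Fiber b₀).linearMapAt 𝕜 b

/-- Near `x₀` the base point stays in the domain of the trivialization at `p x₀`, where `coord` is
its second component; off that domain `coord` has the default value zero. -/
theorem continuousWithinAt_pt (E : VecBundle 𝕜 B) {p : X → B} {s : ∀ x, E.Fiber (p x)} {D : Set X}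
    {x₀ : X} :
    ContinuousWithinAt (fun x => E.pt (p x) (s x)) D x₀ ↔
      ContinuousWithinAt p D x₀ ∧
        ContinuousWithinAt (fun x => E.coord (p x₀) (p x) (s x)) D x₀ := by
  rw [FiberBundle.continuousWithinAt_totalSpace]
  refine and_congr_right fun hp => ?_
  have hb : ∀ᶠ x in 𝓝[D] x₀,
      p x ∈ (trivializationAt (Fin E.rank → 𝕜) E.Fiber (p x₀)).baseSet :=
    hp.eventually ((trivializationAt _ _ _).open_baseSet.mem_nhds
      (FiberBundle.mem_baseSet_trivializationAt' _))
  have he : (fun x => (trivializationAt (Fin E.rank → 𝕜) E.Fiber (p x₀) (E.pt (p x) (s x))).2)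
      =ᶠ[𝓝[D] x₀] fun x => E.coord (p x₀) (p x) (s x) := by
    filter_upwards [hb] with x hx
    rw [coord, Trivialization.coe_linearMapAt_of_mem _ hx]
    rfl
  refine ⟨fun h => ContinuousWithinAt.congr_of_eventuallyEq h he.symm ?_,
    fun h => ContinuousWithinAt.congr_of_eventuallyEq h he ?_⟩ <;>
  · rw [coord, Trivialization.coe_linearMapAt_of_mem _ (FiberBundle.mem_baseSet_trivializationAt' _)]
    rfl

theorem continuousOn_smul_add_smul (E : VecBundle 𝕜 B) {p : X → B} {s t : ∀ x, E.Fiber (p x)}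
    {D : Set X} (hs : ContinuousOn (fun x => E.pt (p x) (s x)) D)
    (ht : ContinuousOn (fun x => E.pt (p x) (t x)) D) (a b : 𝕜) :
    ContinuousOn (fun x => E.pt (p x) (a • s x + b • t x)) D := by
  intro x hx
  have h1 := E.continuousWithinAt_pt.1 (hs x hx)
  have h2 := E.continuousWithinAt_pt.1 (ht x hx)
  refine E.continuousWithinAt_pt.2 ⟨h1.1, ?_⟩
  simp only [map_add, map_smul]
  exact (h1.2.const_smul a).add (h2.2.const_smul b)

/-- `f` is a continuous family, over the set `D`, of linear isomorphisms of `W` with the fibers of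
`E`, along a map `p` to the base. -/
def IsFrame (E : VecBundle 𝕜 B) (p : X → B) (f : ∀ x, W ≃ₗ[𝕜] E.Fiber (p x)) (D : Set X) : Prop :=
  ∀ w, ContinuousOn (fun x => E.pt (p x) (f x w)) D

namespace IsFrame

variable {E : VecBundle 𝕜 B} {p : X → B} {f : ∀ x, W ≃ₗ[𝕜] E.Fiber (p x)} {D : Set X}

theorem mono (hf : E.IsFrame p f D) {D' : Set X} (h : D' ⊆ D) : E.IsFrame p f D' :=
  fun w => (hf w).mono h

theorem comp (hf : E.IsFrame p f D) {Y : Type*} [TopologicalSpace Y] {q : Y → X}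
    (hq : Continuous q) : E.IsFrame (fun y => p (q y)) (fun y => f (q y)) (q ⁻¹' D) :=
  fun w => (hf w).comp hq.continuousOn (Set.mapsTo_preimage _ _)

variable [FiniteDimensional 𝕜 W]

/-- Cramer's rule without determinants: in a local trivialization the frame is a continuous family
of operators, and inversion is continuous at the identity of the Banach algebra of endomorphisms of
`W`. -/
theorem continuousOn_coordinates (hf : E.IsFrame p f D) {s : ∀ x, E.Fiber (p x)}
    (hs : ContinuousOn (fun x => E.pt (p x) (s x)) D) :
    ContinuousOn (fun x => (f x).symm (s x)) D := by
  intro x₀ hx₀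
  let e := trivializationAt (Fin E.rank → 𝕜) E.Fiber (p x₀)
  have he : p x₀ ∈ e.baseSet := FiberBundle.mem_baseSet_trivializationAt' _
  -- Chosen to turn the local expression `T` of the frame into an endomorphism of `W` that is the
  -- identity at `x₀`.
  let K : (Fin E.rank → 𝕜) →ₗ[𝕜] W := (f x₀).symm.toLinearMap ∘ₗ e.symmₗ 𝕜 (p x₀)
  have hK : Continuous K := LinearMap.continuous_of_finiteDimensional K
  let T : X → W →L[𝕜] W := fun x =>
    LinearMap.toContinuousLinearMap (K ∘ₗ E.coord (p x₀) (p x) ∘ₗ (f x).toLinearMap)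
  have hT (x : X) (w : W) : T x w = K (E.coord (p x₀) (p x) (f x w)) := rfl
  have hT0 : T x₀ = 1 := by
    ext w
    simp only [hT, K, coord, LinearMap.comp_apply]
    rw [Trivialization.symmₗ_linearMapAt _ he]
    simp
  have hTc : ContinuousWithinAt T D x₀ := by
    rw [continuousWithinAt_clm_apply]
    intro w
    exact hK.continuousAt.comp_continuousWithinAt
      (E.continuousWithinAt_pt.1 (hf w x₀ hx₀)).2
  have hsc : ContinuousWithinAt (fun x => K (E.coord (p x₀) (p x) (s x))) D x₀ :=
    hK.continuousAt.comp_continuousWithinAt (E.continuousWithinAt_pt.1 (hs x₀ hx₀)).2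
  have : CompleteSpace W := FiniteDimensional.complete 𝕜 W
  have hinv : ContinuousWithinAt (fun x => Ring.inverse (T x)) D x₀ := by
    refine ContinuousAt.comp_continuousWithinAt (g := Ring.inverse) ?_ hTc
    rw [hT0]
    exact NormedRing.inverse_continuousAt (1 : (W →L[𝕜] W)ˣ)
  have hunit : ∀ᶠ x in 𝓝[D] x₀, IsUnit (T x) :=
    hTc.eventually (Units.isOpen.mem_nhds (by rw [hT0]; exact isUnit_one))
  have key (x : X) (hx : IsUnit (T x)) :
      Ring.inverse (T x) (K (E.coord (p x₀) (p x) (s x))) = (f x).symm (s x) := by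
    have h1 : K (E.coord (p x₀) (p x) (s x)) = T x ((f x).symm (s x)) := by
      rw [hT, LinearEquiv.apply_symm_apply]
    rw [h1, ← mul_apply_eq_comp, Ring.inverse_mul_cancel _ hx]
    rfl
  refine ContinuousWithinAt.congr_of_eventuallyEq (hinv.clm_apply hsc) ?_ ?_
  · filter_upwards [hunit] with x hx using (key x hx).symm
  · exact (key x₀ (by rw [hT0]; exact isUnit_one)).symm

theorem continuousOn_apply (hf : E.IsFrame p f D) {c : X → W} (hc : ContinuousOn c D) :
    ContinuousOn (fun x => E.pt (p x) (f x (c x))) D := by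
  intro x₀ hx₀
  refine E.continuousWithinAt_pt.2
    ⟨(E.continuousWithinAt_pt.1 (hf 0 x₀ hx₀)).1, ?_⟩
  let T : X → W →L[𝕜] (Fin E.rank → 𝕜) := fun x =>
    LinearMap.toContinuousLinearMap (E.coord (p x₀) (p x) ∘ₗ (f x).toLinearMap)
  have hTc : ContinuousWithinAt T D x₀ := by
    rw [continuousWithinAt_clm_apply]
    intro w
    exact (E.continuousWithinAt_pt.1 (hf w x₀ hx₀)).2
  exact hTc.clm_apply (hc x₀ hx₀)

end IsFrame

theorem pt_eq_pt (E : VecBundle 𝕜 B) {b : B} {v w : E.Fiber b} : E.pt b v = E.pt b w ↔ v = w :=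
  ⟨fun h => by simpa [pt] using h, fun h => by rw [h]⟩

/-- Transport between fibers whose base points are equal only propositionally, phrased through
points of the total space to avoid casts. -/
theorem exists_equiv_of_eq (E : VecBundle 𝕜 B) {b b' : B} (h : b = b') :
    ∃ L : E.Fiber b ≃ₗ[𝕜] E.Fiber b', ∀ v, E.pt b' (L v) = E.pt b v := by
  subst h
  exact ⟨LinearEquiv.refl _ _, fun _ => rfl⟩

/-- Fiberwise linear isomorphisms that are continuous on total spaces in both directions form an
isomorphism of vector bundles. -/
theorem isIso_of_equiv {E E' : VecBundle 𝕜 B} (L : ∀ x, E.Fiber x ≃ₗ[𝕜] E'.Fiber x)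
    (h : Continuous fun e : E.Total => E'.pt e.1 (L e.1 e.2))
    (h' : Continuous fun e : E'.Total => E.pt e.1 ((L e.1).symm e.2)) : E.IsIso E' :=
  ⟨{ toFun := fun e => E'.pt e.1 (L e.1 e.2)
     invFun := fun e => E.pt e.1 ((L e.1).symm e.2)
     left_inv := fun e => congrArg (E.pt e.1) ((L e.1).symm_apply_apply e.2)
     right_inv := fun e => congrArg (E'.pt e.1) ((L e.1).apply_symm_apply e.2)
     continuous_toFun := h
     continuous_invFun := h' }, fun x => L x, fun _ _ => rfl⟩

end VecBundle

/-! ### A criterion for biquotient bundles -/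

section Criterion

variable {G H : Type} [Group G] [Group H] [TopologicalSpace G] [TopologicalSpace H]
  {𝕜 : Type} [RCLike 𝕜] {M : Type} [TopologicalSpace M]
  (P : Biquotient G H) (e : P.Space ≃ₜ M)

theorem Biquotient.proj_eq_iff {g g' : G} : P.proj g = P.proj g' ↔ ∃ h, g' = P.star h g :=
  Quotient.eq (r := P.orbitSetoid)

theorem Biquotient.assocMk_eq_iff {n : ℕ} (ρ : Representation 𝕜 H (Fin n → 𝕜)) {g g' : G}
    {v v' : Fin n → 𝕜} :
    P.assocMk ρ g v = P.assocMk ρ g' v' ↔ ∃ h, g' = P.star h g ∧ v' = ρ h v := by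
  refine (Quotient.eq (r := P.assocSetoid ρ)).trans (exists_congr fun h => ?_)
  exact Prod.ext_iff

theorem Biquotient.proj_surjective : Function.Surjective P.proj := Quotient.exists_rep

theorem Biquotient.continuous_proj : Continuous P.proj := continuous_quotient_mk'

theorem Biquotient.continuous_assocMk {n : ℕ} (ρ : Representation 𝕜 H (Fin n → 𝕜)) :
    Continuous fun q : G × (Fin n → 𝕜) => P.assocMk ρ q.1 q.2 :=
  continuous_quotient_mk'

theorem mem_biquotientBundles_of_isIso {E E' : VecBundle 𝕜 M} (h : E.IsIso E')
    (hE : E ∈ biquotientBundles 𝕜 P e) : E' ∈ biquotientBundles 𝕜 P e := by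
  obtain ⟨n, ρ, hρ, Φ, L, hΦ⟩ := hE
  obtain ⟨Ψ, K, hΨ⟩ := h
  exact ⟨n, ρ, hρ, Φ.trans Ψ, fun g => K _ ∘ₗ L g, fun g v => by simp [hΦ, hΨ]⟩

/-- Since the action on `G` is free, each class in `G ×_H V` over `[g]` has exactly one
representative `(g, v)`. This makes every `L g` bijective. -/
theorem exists_frame_of_mem_biquotientBundles {E : VecBundle 𝕜 M}
    (hE : E ∈ biquotientBundles 𝕜 P e) :
    ∃ (n : ℕ) (ρ : Representation 𝕜 H (Fin n → 𝕜)),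
      Continuous (fun p : H × (Fin n → 𝕜) => ρ p.1 p.2) ∧
      ∃ F : ∀ g : G, (Fin n → 𝕜) ≃ₗ[𝕜] E.Fiber (e (P.proj g)),
        E.IsFrame (fun g => e (P.proj g)) F Set.univ ∧
        ∀ h g v, E.pt (e (P.proj (P.star h g))) (F (P.star h g) (ρ h v)) =
          E.pt (e (P.proj g)) (F g v) := by
  obtain ⟨n, ρ, hρ, Φ, L, hΦ⟩ := hE
  have hbij (g : G) : Function.Bijective (L g) := by
    constructor
    · intro v w hvw
      have : P.assocMk ρ g v = P.assocMk ρ g w := Φ.injective (by rw [hΦ, hΦ, hvw])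
      obtain ⟨h, h1, h2⟩ := (P.assocMk_eq_iff ρ).1 this
      rw [P.free h g h1.symm] at h2
      simpa using h2.symm
    · intro v
      obtain ⟨q, hq⟩ := Φ.surjective (E.pt (e (P.proj g)) v)
      obtain ⟨⟨g', v'⟩, rfl⟩ := Quotient.exists_rep q
      have hq' : E.pt (e (P.proj g')) (L g' v') = E.pt (e (P.proj g)) v := (hΦ g' v').symm.trans hq
      have hb : e (P.proj g') = e (P.proj g) := congrArg TotalSpace.proj hq'
      obtain ⟨h, rfl⟩ := P.proj_eq_iff.1 (e.injective hb)
      refine ⟨ρ h v', ?_⟩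
      have : P.assocMk ρ g' v' = P.assocMk ρ (P.star h g') (ρ h v') :=
        (P.assocMk_eq_iff ρ).2 ⟨h, rfl, rfl⟩
      rw [← E.pt_eq_pt, ← hΦ, ← this, hΦ, hq']
  refine ⟨n, ρ, hρ, fun g => LinearEquiv.ofBijective (L g) (hbij g), fun v => ?_, fun h g v => ?_⟩
  · refine Continuous.continuousOn ?_
    simp only [LinearEquiv.ofBijective_apply, ← hΦ]
    exact Φ.continuous.comp ((P.continuous_assocMk ρ).comp (by fun_prop : Continuous fun g : G => (g, v)))
  · simp only [LinearEquiv.ofBijective_apply, ← hΦ]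
    exact congrArg Φ ((P.assocMk_eq_iff ρ).2 ⟨h, rfl, rfl⟩).symm

/-- Equivariance lets the frame descend to a continuous bijection `φ` from `G ×_H V`. Compactness of
`G` gives continuity of the inverse. -/
theorem mem_biquotientBundles_of_frame [CompactSpace G] [T2Space M] {E : VecBundle 𝕜 M} {n : ℕ}
    (ρ : Representation 𝕜 H (Fin n → 𝕜))
    (hρ : Continuous (fun p : H × (Fin n → 𝕜) => ρ p.1 p.2))
    (F : ∀ g : G, (Fin n → 𝕜) ≃ₗ[𝕜] E.Fiber (e (P.proj g)))
    (hF : E.IsFrame (fun g => e (P.proj g)) F Set.univ)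
    (hequiv : ∀ h g v, E.pt (e (P.proj (P.star h g))) (F (P.star h g) (ρ h v)) =
      E.pt (e (P.proj g)) (F g v)) :
    E ∈ biquotientBundles 𝕜 P e := by
  have hp : Continuous fun g => e (P.proj g) := e.continuous.comp P.continuous_proj
  let φ : P.Assoc ρ → E.Total :=
    Quotient.lift (fun q => E.pt (e (P.proj q.1)) (F q.1 q.2)) (by
      rintro ⟨g, v⟩ _ ⟨h, rfl⟩
      exact (hequiv h g v).symm)
  have hφ (g : G) (v : Fin n → 𝕜) : φ (P.assocMk ρ g v) = E.pt (e (P.proj g)) (F g v) := rfl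
  have hφc : Continuous φ := by
    refine Continuous.quotient_lift ?_ _
    have := (hF.comp continuous_fst).continuousOn_apply (c := fun q : G × (Fin n → 𝕜) => q.2)
      continuous_snd.continuousOn
    simpa using this
  have hφb : Function.Bijective φ := by
    constructor
    · intro q q' hqq'
      obtain ⟨⟨g, v⟩, rfl⟩ := Quotient.exists_rep q
      obtain ⟨⟨g', v'⟩, rfl⟩ := Quotient.exists_rep q'
      change E.pt (e (P.proj g)) (F g v) = E.pt (e (P.proj g')) (F g' v') at hqq'
      have hb : e (P.proj g) = e (P.proj g') := congrArg TotalSpace.proj hqq'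
      obtain ⟨h, rfl⟩ := P.proj_eq_iff.1 (e.injective hb)
      rw [← hequiv h g v, E.pt_eq_pt] at hqq'
      exact (P.assocMk_eq_iff ρ).2 ⟨h, rfl, ((F _).injective hqq').symm⟩
    · rintro ⟨x, v⟩
      obtain ⟨q, rfl⟩ := e.surjective x
      obtain ⟨g, rfl⟩ := P.proj_surjective q
      exact ⟨P.assocMk ρ g ((F g).symm v), by rw [hφ, LinearEquiv.apply_symm_apply]; rfl⟩
  let φe := Equiv.ofBijective φ hφb
  -- The fibre product of `G` and the total space over `M`. Its projection `r` is closed because `G`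
  -- is compact, hence a quotient map, and on `Y` the inverse of `φ` is given by frame coordinates.
  let Y : Set (G × E.Total) := {y | e (P.proj y.1) = y.2.1}
  have hproj : Continuous fun q : E.Total => q.1 := FiberBundle.continuous_proj _ _
  have hY : IsClosed Y := isClosed_eq (hp.comp continuous_fst) (hproj.comp continuous_snd)
  let r : Y → E.Total := fun y => y.1.2
  have hrc : Continuous r := continuous_snd.comp continuous_subtype_val
  have hrs : Function.Surjective r := by
    rintro ⟨x, v⟩
    obtain ⟨q, rfl⟩ := e.surjective x
    obtain ⟨g, rfl⟩ := P.proj_surjective q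
    exact ⟨⟨(g, ⟨_, v⟩), rfl⟩, rfl⟩
  have hrcl : IsClosedMap r :=
    isClosedMap_snd_of_compactSpace.comp hY.isClosedMap_subtype_val
  have hrq : IsQuotientMap r := hrcl.isQuotientMap hrc hrs
  choose K hK using fun y : Y => E.exists_equiv_of_eq y.2.symm
  have hs : ContinuousOn (fun y : Y => E.pt (e (P.proj y.1.1)) (K y y.1.2.2)) Set.univ := by
    simp only [hK]
    exact hrc.continuousOn
  have hcoord := ((hF.comp (continuous_fst.comp continuous_subtype_val)).mono
    (D' := (Set.univ : Set Y)) (Set.subset_univ _)).continuousOn_coordinates hs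
  rw [← continuousOn_univ.symm] at hcoord
  have hinv : Continuous φe.symm := by
    rw [hrq.continuous_iff]
    have : φe.symm ∘ r = fun y : Y => P.assocMk ρ y.1.1 ((F y.1.1).symm (K y y.1.2.2)) := by
      funext y
      rw [Function.comp_apply, Equiv.symm_apply_eq]
      refine Eq.trans ?_ (hφ _ _).symm
      rw [LinearEquiv.apply_symm_apply, hK]
      rfl
    rw [this]
    exact (P.continuous_assocMk ρ).comp
      ((continuous_fst.comp continuous_subtype_val).prodMk hcoord)
  exact ⟨n, ρ, hρ, ⟨φe, hφc, hinv⟩, fun g => F g, hφ⟩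

end Criterion

/-! ### Continuous logarithms -/

/-- Lifting along the covering `exp : ℂ → ℂ ∖ {0}`. -/
theorem exists_continuous_log {X : Type*} [TopologicalSpace X] [SimplyConnectedSpace X]
    [LocallyPathConnectedSpace X] {f : X → ℂ} (hf : Continuous f) (h0 : ∀ x, f x ≠ 0) :
    ∃ g : X → ℂ, Continuous g ∧ ∀ x, Complex.exp (g x) = f x := by
  obtain ⟨a⟩ : Nonempty X := inferInstance
  obtain ⟨g, ⟨-, hg⟩, -⟩ := Complex.isCoveringMapOn_exp.existsUnique_continuousMap_lifts
    ⟨f, hf⟩ (a₀ := a) (e₀ := Complex.log (f a)) (Complex.exp_log (h0 a)) h0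
  exact ⟨g, g.continuous, congrFun hg⟩

/-- Two logarithms of one function differ by a constant: `h` shifted to agree with `g` at `y` is a
lift of the same map, and lifts from a connected space are unique. -/
theorem sub_eq_sub_of_exp_eq {X : Type*} [TopologicalSpace X] [PreconnectedSpace X] {g h : X → ℂ}
    (hg : Continuous g) (hh : Continuous h) (he : ∀ x, Complex.exp (g x) = Complex.exp (h x))
    (x y : X) : g x - h x = g y - h y := by
  have := Complex.isCoveringMap_exp.eq_of_comp_eq hg
    (hh.add (continuous_const (y := g y - h y))) (by
      funext x
      apply Subtype.ext
      simp [Complex.exp_add, Complex.exp_sub, he, Complex.exp_ne_zero]) y (by simp)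
  rw [this]
  simp

/-! ### Clutching -/

/-- The first two coordinates of a point of the sphere, as a complex number. -/
def planar (x : S2) : ℂ := x.1 0 + x.1 1 * Complex.I

theorem continuous_coord (i : Fin 3) : Continuous fun x : S2 => x.1 i :=
  (EuclideanSpace.proj (𝕜 := ℝ) i).continuous.comp continuous_subtype_val

theorem continuous_planar : Continuous planar :=
  (Complex.continuous_ofReal.comp (continuous_coord 0)).add
    ((Complex.continuous_ofReal.comp (continuous_coord 1)).mul continuous_const)

theorem isClosed_upper : IsClosed upper := isClosed_le continuous_const (continuous_coord 2)

theorem isClosed_lower : IsClosed lower := isClosed_le (continuous_coord 2) continuous_const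

section Clutching

variable {𝕜 : Type} [RCLike 𝕜] [NormedSpace 𝕜 ℂ]

/-- `E` is glued from trivial bundles with fiber `ℂ` over the closed hemispheres, with the
identity map of the unit circle as clutching function. -/
def IsClutched (E : VecBundle 𝕜 S2) : Prop :=
  ∃ fU fL : ∀ x, ℂ ≃ₗ[𝕜] E.Fiber x, E.IsFrame id fU upper ∧ E.IsFrame id fL lower ∧
    ∀ x, x.1 2 = 0 → ∀ c, fL x c = fU x (planar x * c)

variable [FiniteDimensional 𝕜 ℂ]

theorem continuousOn_frame_change {E E' : VecBundle 𝕜 S2} {f : ∀ x, ℂ ≃ₗ[𝕜] E.Fiber x}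
    {f' : ∀ x, ℂ ≃ₗ[𝕜] E'.Fiber x} {D : Set S2} (hf : E.IsFrame id f D) (hf' : E'.IsFrame id f' D) :
    ContinuousOn (fun e : E.Total => E'.pt e.1 (f' e.1 ((f e.1).symm e.2)))
      (TotalSpace.proj ⁻¹' D) := by
  have hp : Continuous fun e : E.Total => e.1 := FiberBundle.continuous_proj _ _
  exact (hf'.comp hp).continuousOn_apply
    ((hf.comp hp).continuousOn_coordinates continuous_id.continuousOn)

/-- Isomorphisms over the two hemispheres that agree over the equator are continuous together. -/
theorem continuous_glue {E E' : VecBundle 𝕜 S2} (L : ∀ x, E.Fiber x ≃ₗ[𝕜] E'.Fiber x)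
    {fU fL : ∀ x, ℂ ≃ₗ[𝕜] E.Fiber x} {fU' fL' : ∀ x, ℂ ≃ₗ[𝕜] E'.Fiber x}
    (hU : E.IsFrame id fU upper) (hL : E.IsFrame id fL lower)
    (hU' : E'.IsFrame id fU' upper) (hL' : E'.IsFrame id fL' lower)
    (h : ∀ x ∈ upper, ∀ v, L x v = fU' x ((fU x).symm v))
    (h' : ∀ x ∈ lower, ∀ v, L x v = fL' x ((fL x).symm v)) :
    Continuous fun e : E.Total => E'.pt e.1 (L e.1 e.2) := by
  have hp : Continuous fun e : E.Total => e.1 := FiberBundle.continuous_proj _ _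
  rw [← continuousOn_univ]
  have hcov : (Set.univ : Set E.Total) = TotalSpace.proj ⁻¹' upper ∪ TotalSpace.proj ⁻¹' lower :=
    by
    ext e
    simpa [upper, lower] using le_total 0 (e.1.1 2)
  rw [hcov]
  refine ContinuousOn.union_of_isClosed ?_ ?_ (isClosed_upper.preimage hp)
    (isClosed_lower.preimage hp)
  · exact (continuousOn_frame_change hU hU').congr fun e he => congrArg _ (h _ he _)
  · exact (continuousOn_frame_change hL hL').congr fun e he => congrArg _ (h' _ he _)

/-- Both bundles have the same transition function, so the isomorphisms given by the frames over the
hemispheres agree on the equator. -/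
theorem IsClutched.isIso {E E' : VecBundle 𝕜 S2} (hE : IsClutched E) (hE' : IsClutched E') :
    E.IsIso E' := by
  obtain ⟨fU, fL, hU, hL, h⟩ := hE
  obtain ⟨fU', fL', hU', hL', h'⟩ := hE'
  classical
  let L (x : S2) : E.Fiber x ≃ₗ[𝕜] E'.Fiber x :=
    if 0 ≤ x.1 2 then (fU x).symm.trans (fU' x) else (fL x).symm.trans (fL' x)
  have h1 (x) (hx : x ∈ upper) : L x = (fU x).symm.trans (fU' x) := if_pos hx
  have h2 (x) (hx : x ∈ lower) : L x = (fL x).symm.trans (fL' x) := by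
    by_cases hx0 : x.1 2 = 0
    · rw [h1 x (show 0 ≤ x.1 2 from hx0.ge)]
      ext v
      obtain ⟨c, rfl⟩ := (fL x).surjective v
      simp [h x hx0, h' x hx0]
      simp [← h x hx0]
    · exact if_neg fun hx' => hx0 (le_antisymm hx hx')
  refine VecBundle.isIso_of_equiv L ?_ ?_
  · exact continuous_glue L hU hL hU' hL' (fun x hx v => by rw [h1 x hx]; rfl)
      (fun x hx v => by rw [h2 x hx]; rfl)
  · exact continuous_glue (fun x => (L x).symm) hU' hL' hU hL (fun x hx v => by rw [h1 x hx]; rfl)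
      (fun x hx v => by rw [h2 x hx]; rfl)

end Clutching

/-! ### The pullback to `SO(3)` -/

/-- Rotation about the third axis. -/
def rotZ (t : ℝ) : SO3 := ⟨!![Real.cos t, -Real.sin t, 0; Real.sin t, Real.cos t, 0; 0, 0, 1], by
  rw [Matrix.mem_specialOrthogonalGroup_iff, Matrix.mem_orthogonalGroup_iff]
  have := Real.sin_sq_add_cos_sq t
  constructor
  · ext i j
    fin_cases i <;> fin_cases j <;>
      simp [Matrix.mul_apply, Fin.sum_univ_three] <;> grind
  · simp [Matrix.det_fin_three]; grind⟩

/-- Rotation about the second axis, by an angle with cosine `c` and sine `s`. -/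
def rotY (c s : ℝ) (h : c ^ 2 + s ^ 2 = 1) : SO3 := ⟨!![c, 0, s; 0, 1, 0; -s, 0, c], by
  rw [Matrix.mem_specialOrthogonalGroup_iff, Matrix.mem_orthogonalGroup_iff]
  constructor
  · ext i j
    fin_cases i <;> fin_cases j <;>
      simp [Matrix.mul_apply, Fin.sum_univ_three] <;> grind
  · simp [Matrix.det_fin_three]; grind⟩

theorem SO3.ext_entries {A B : SO3} (h : ∀ i j, A.1 i j = B.1 i j) : A = B :=
  Subtype.ext (Matrix.ext h)

theorem continuous_rotZ : Continuous rotZ := by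
  refine Continuous.subtype_mk (continuous_matrix fun i j => ?_) _
  fin_cases i <;> fin_cases j <;> simp <;> fun_prop

theorem continuous_rotY {X : Type*} [TopologicalSpace X] {c s : X → ℝ} (hc : Continuous c)
    (hs : Continuous s) (h : ∀ x, c x ^ 2 + s x ^ 2 = 1) :
    Continuous fun x => rotY (c x) (s x) (h x) := by
  refine Continuous.subtype_mk (continuous_matrix fun i j => ?_) _
  fin_cases i <;> fin_cases j <;> simp <;> fun_prop

theorem rotZ_add (t s : ℝ) : rotZ (t + s) = rotZ t * rotZ s := by
  refine SO3.ext_entries fun i j => ?_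
  fin_cases i <;> fin_cases j <;>
    simp [rotZ, Real.cos_add, Real.sin_add] <;> ring

theorem rotZ_zero : rotZ 0 = 1 := by
  refine SO3.ext_entries fun i j => ?_
  fin_cases i <;> fin_cases j <;> simp [rotZ]

theorem rotZ_two_pi : rotZ (2 * Real.pi) = 1 := by
  refine SO3.ext_entries fun i j => ?_
  fin_cases i <;> fin_cases j <;> simp [rotZ]

theorem rotZ_neg_two_pi : rotZ (-(2 * Real.pi)) = 1 := by
  have := rotZ_add (2 * Real.pi) (-(2 * Real.pi))
  rwa [add_neg_cancel, rotZ_zero, rotZ_two_pi, one_mul, eq_comm] at this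

theorem rotY_one (h : (1 : ℝ) ^ 2 + 0 ^ 2 = 1) : rotY 1 0 h = 1 := by
  refine SO3.ext_entries fun i j => ?_
  fin_cases i <;> fin_cases j <;> simp [rotY]

theorem rotZ_mul_rotY_neg_one (h : (-1 : ℝ) ^ 2 + 0 ^ 2 = 1) (t : ℝ) :
    rotZ t * rotY (-1) 0 h = rotY (-1) 0 h * rotZ (-t) := by
  refine SO3.ext_entries fun i j => ?_
  fin_cases i <;> fin_cases j <;> simp [rotY, rotZ]

theorem lastColumn_euler (t c s : ℝ) (h : c ^ 2 + s ^ 2 = 1) (t' : ℝ) :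
    (lastColumn (rotZ t * rotY c s h * rotZ t')).1 2 = c ∧
      planar (lastColumn (rotZ t * rotY c s h * rotZ t')) = s * Complex.exp (t * Complex.I) := by
  rw [Complex.exp_mul_I]
  constructor
  · simp [lastColumn, S2.mk, rotZ, rotY]
  · simp [planar, lastColumn, S2.mk, rotZ, rotY]
    ring

/-- The pullback to `SO(3)` of the Hopf line bundle has no nowhere zero section. -/
theorem no_clutched_section {u l : SO3 → ℂ}
    (hu : ContinuousOn u (lastColumn ⁻¹' upper)) (hl : ContinuousOn l (lastColumn ⁻¹' lower))
    (hu0 : ∀ A, u A ≠ 0) (hl0 : ∀ A, l A ≠ 0)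
    (h : ∀ A, (lastColumn A).1 2 = 0 → u A = planar (lastColumn A) * l A) : False := by
  -- Euler angles for the preimages of the hemispheres: the absolute value keeps the height `|cos
  -- r|` or `-|cos r|` of the right sign for every real `r`, so the parameter space is all of `ℝ³`
  -- and logarithms exist on it.
  have hcs (r : ℝ) : |Real.cos r| ^ 2 + Real.sin r ^ 2 = 1 := by
    rw [sq_abs, Real.cos_sq_add_sin_sq]
  have hcs' (r : ℝ) : (-|Real.cos r|) ^ 2 + Real.sin r ^ 2 = 1 := by rw [neg_sq, hcs]
  let a (q : ℝ × ℝ × ℝ) : SO3 := rotZ q.2.1 * rotY _ _ (hcs q.1) * rotZ q.2.2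
  let b (q : ℝ × ℝ × ℝ) : SO3 := rotZ q.2.1 * rotY _ _ (hcs' q.1) * rotZ q.2.2
  have hYa : Continuous fun q : ℝ × ℝ × ℝ => rotY _ _ (hcs q.1) :=
    continuous_rotY (by fun_prop) (by fun_prop) _
  have hYb : Continuous fun q : ℝ × ℝ × ℝ => rotY _ _ (hcs' q.1) :=
    continuous_rotY (by fun_prop) (by fun_prop) _
  have ha : Continuous a := ((continuous_rotZ.comp (by fun_prop)).mul hYa).mul
    (continuous_rotZ.comp (by fun_prop))
  have hb : Continuous b := ((continuous_rotZ.comp (by fun_prop)).mul hYb).mul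
    (continuous_rotZ.comp (by fun_prop))
  have hua : Continuous (u ∘ a) := hu.comp_continuous ha fun q => by
    have := (lastColumn_euler q.2.1 _ _ (hcs q.1) q.2.2).1
    exact (abs_nonneg _).trans_eq this.symm
  have hlb : Continuous (l ∘ b) := hl.comp_continuous hb fun q => by
    have := (lastColumn_euler q.2.1 _ _ (hcs' q.1) q.2.2).1
    exact (this.trans_le (neg_nonpos.2 (abs_nonneg _)))
  obtain ⟨gU, hgU, heU⟩ := exists_continuous_log hua fun q => hu0 _
  obtain ⟨gL, hgL, heL⟩ := exists_continuous_log hlb fun q => hl0 _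
  have ha_loop (r : ℝ) : a (r, 2 * Real.pi, 0) = a (r, 0, 2 * Real.pi) := by
    simp [a, rotZ_two_pi, rotZ_zero]
  have hb_loop (r : ℝ) : b (r, 2 * Real.pi, 0) = b (r, 0, -(2 * Real.pi)) := by
    simp [b, rotZ_two_pi, rotZ_zero, rotZ_neg_two_pi]
  -- Over the north pole, turning the base angle is turning the fibre; over the south pole the
  -- direction is reversed. This sign is the source of the contradiction.
  have ha_pole (t : ℝ) : a (0, t, 0) = a (0, 0, t) := by
    simp [a, rotZ_zero, rotY_one]
  have hb_pole (t : ℝ) : b (0, t, 0) = b (0, 0, -t) := by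
    simp [b, rotZ_zero, rotZ_mul_rotY_neg_one]
  -- Comparing the base loop with the fibre loop at the pole (`hU0`, `hL0`) and moving from `r = 0`
  -- to the equator `r = π / 2` (`hU1`, `hL1`) shows that the logarithms have equal increments along
  -- both loops over the equator.
  have hU0 := sub_eq_sub_of_exp_eq (g := fun t : ℝ => gU (0, t, 0)) (h := fun t => gU (0, 0, t))
    (by fun_prop) (by fun_prop) (fun t => by simp [heU, ha_pole]) (2 * Real.pi) 0
  have hL0 := sub_eq_sub_of_exp_eq (g := fun t : ℝ => gL (0, t, 0)) (h := fun t => gL (0, 0, -t))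
    (by fun_prop) (by fun_prop) (fun t => by simp [heL, hb_pole]) (2 * Real.pi) 0
  have hU1 := sub_eq_sub_of_exp_eq (g := fun r : ℝ => gU (r, 2 * Real.pi, 0))
    (h := fun r => gU (r, 0, 2 * Real.pi)) (by fun_prop) (by fun_prop)
    (fun r => by simp [heU, ha_loop]) (Real.pi / 2) 0
  have hL1 := sub_eq_sub_of_exp_eq (g := fun r : ℝ => gL (r, 2 * Real.pi, 0))
    (h := fun r => gL (r, 0, -(2 * Real.pi))) (by fun_prop) (by fun_prop)
    (fun r => by simp [heL, hb_loop]) (Real.pi / 2) 0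
  -- Over the equator `a` and `b` coincide and the clutching relation reads `gU = i t + gL` up to a
  -- constant. The two evaluation points are the ones identified by `hL0` and `hL1`.
  have hUL := sub_eq_sub_of_exp_eq (g := fun q : ℝ × ℝ => gU (Real.pi / 2, q))
    (h := fun q : ℝ × ℝ => q.1 * Complex.I + gL (Real.pi / 2, q)) (by fun_prop) (by fun_prop)
    (fun q => by
      have hab : b (Real.pi / 2, q) = a (Real.pi / 2, q) := by simp [a, b]
      have := lastColumn_euler q.1 _ _ (hcs (Real.pi / 2)) q.2
      have h1 := h (a (Real.pi / 2, q)) (this.1.trans (by simp))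
      have h2 : planar (lastColumn (a (Real.pi / 2, q))) = Complex.exp (q.1 * Complex.I) :=
        this.2.trans (by simp)
      rw [Complex.exp_add, heU, heL, Function.comp_apply, Function.comp_apply, hab, h1, h2])
    (2 * Real.pi, 0) (0, -(2 * Real.pi))
  have hper (s : ℝ) : a (Real.pi / 2, 0, s + 2 * Real.pi) = a (Real.pi / 2, 0, s) := by
    simp [a, rotZ_add, rotZ_two_pi]
  -- The increment of `gU` over one fibre period does not depend on where the period starts; it
  -- equals `2πi m` by `hm`.
  have hd := sub_eq_sub_of_exp_eq (g := fun s : ℝ => gU (Real.pi / 2, 0, s + 2 * Real.pi))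
    (h := fun s : ℝ => gU (Real.pi / 2, 0, s)) (by fun_prop) (by fun_prop)
    (fun s => by simp [heU, hper]) 0 (-(2 * Real.pi))
  have hint : Complex.exp (gU (Real.pi / 2, 0, 0 + 2 * Real.pi)) =
      Complex.exp (gU (Real.pi / 2, 0, 0)) := by
    rw [heU, heU, Function.comp_apply, Function.comp_apply, hper]
  obtain ⟨m, hm⟩ := Complex.exp_eq_exp_iff_exists_int.1 hint
  simp only [zero_add, neg_zero, sub_self, neg_add_cancel] at hm hU0 hL0 hd
  push_cast at hUL
  -- From `-2π` to `2π` along the fibre, `gU` increases by two periods, `2 · 2πi m`, while `hUL`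
  -- says that it increases by `2πi`.
  have key : (2 * m - 1 : ℂ) * (2 * Real.pi * Complex.I) = 0 := by
    linear_combination -2 * hm + hd - hU1 - hU0 + hUL + hL1 + hL0
  have h2 : (2 * m - 1 : ℂ) = 0 := by
    simpa [Real.pi_ne_zero] using key
  have h3 : (2 * m - 1 : ℤ) = 0 := by exact_mod_cast h2
  omega

/-- A fixed nonzero vector, moved by the frame on `SO(3)`, would be a nowhere zero section of the
pullback. Its coordinates in the two hemisphere frames are excluded by `no_clutched_section`. -/
theorem IsClutched.notMem_biquotientBundles {𝕜 : Type} [RCLike 𝕜] [NormedSpace 𝕜 ℂ]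
    [FiniteDimensional 𝕜 ℂ] {E : VecBundle 𝕜 S2} (hE : IsClutched E) :
    E ∉ biquotientBundles 𝕜 SO3modSO2 SO3modSO2.homeo := by
  intro hmem
  obtain ⟨fU, fL, hU, hL, h⟩ := hE
  obtain ⟨n, ρ, -, F, hF, -⟩ := exists_frame_of_mem_biquotientBundles _ _ hmem
  change ∀ A : SO3, (Fin n → 𝕜) ≃ₗ[𝕜] E.Fiber (lastColumn A) at F
  change E.IsFrame lastColumn F Set.univ at hF
  -- The model fibre `ℂ` is nonzero, so `n` is not zero.
  obtain ⟨v, hv⟩ : ∃ v : Fin n → 𝕜, v ≠ 0 :=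
    ⟨(F 1).symm (fU _ 1), by simp⟩
  have hs (D : Set SO3) : ContinuousOn (fun A => E.pt (lastColumn A) (F A v)) D :=
    (hF v).mono (Set.subset_univ _)
  refine no_clutched_section
    ((hU.comp continuous_lastColumn).continuousOn_coordinates (hs _))
    ((hL.comp continuous_lastColumn).continuousOn_coordinates (hs _)) ?_ ?_ ?_
  · simp [hv]
  · simp [hv]
  · intro A hA
    rw [LinearEquiv.symm_apply_eq]
    exact (((fL _).apply_symm_apply _).symm.trans (h _ hA _))

/-! ### The double cover and the inclusion of bundle classes -/

/-- The double cover `SU(2) → SO(3)`: the action of `A` by conjugation on the traceless Hermitian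
matrices, in the Pauli basis. -/
def doubleCover (A : SU2) : SO3 :=
  let a₁ := (A.1 0 0).re
  let a₂ := (A.1 0 0).im
  let b₁ := (A.1 1 0).re
  let b₂ := (A.1 1 0).im
  ⟨!![a₁ ^ 2 - a₂ ^ 2 - b₁ ^ 2 + b₂ ^ 2, 2 * (a₁ * a₂) - 2 * (b₁ * b₂), 2 * (a₁ * b₁ + a₂ * b₂);
      -(2 * (a₁ * a₂)) - 2 * (b₁ * b₂), a₁ ^ 2 - a₂ ^ 2 + b₁ ^ 2 - b₂ ^ 2, 2 * (a₁ * b₂ - a₂ * b₁);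
      -(2 * (a₁ * b₁ - a₂ * b₂)), -(2 * (a₁ * b₂ + a₂ * b₁)),
        a₁ ^ 2 + a₂ ^ 2 - b₁ ^ 2 - b₂ ^ 2], by
    have h := A.entries.2.2
    change a₁ ^ 2 + a₂ ^ 2 + b₁ ^ 2 + b₂ ^ 2 = 1 at h
    generalize a₁ = a₁ at *
    generalize a₂ = a₂ at *
    generalize b₁ = b₁ at *
    generalize b₂ = b₂ at *
    rw [Matrix.mem_specialOrthogonalGroup_iff, Matrix.mem_orthogonalGroup_iff]
    constructor
    -- With `s` the sum of the four squares, the rows are orthogonal with norm squared `s²` and the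
    -- determinant is `s³`; the coefficients below are those factoring `s² - 1` and `s³ - 1` by `s -
    -- 1`.
    · ext i j
      fin_cases i <;> fin_cases j <;>
        simp [Matrix.mul_apply, Fin.sum_univ_three] <;>
        first
        | ring1
        | linear_combination (a₁ ^ 2 + a₂ ^ 2 + b₁ ^ 2 + b₂ ^ 2 + 1) * h
    · simp [Matrix.det_fin_three]
      linear_combination ((a₁ ^ 2 + a₂ ^ 2 + b₁ ^ 2 + b₂ ^ 2) ^ 2 +
        (a₁ ^ 2 + a₂ ^ 2 + b₁ ^ 2 + b₂ ^ 2) + 1) * h⟩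

theorem continuous_entry (i j : Fin 2) : Continuous fun A : SU2 => A.1 i j :=
  continuous_subtype_val.matrix_elem _ _

theorem continuous_doubleCover : Continuous doubleCover := by
  have h1 : Continuous fun A : SU2 => (A.1 0 0).re := Complex.continuous_re.comp (continuous_entry 0 0)
  have h2 : Continuous fun A : SU2 => (A.1 0 0).im := Complex.continuous_im.comp (continuous_entry 0 0)
  have h3 : Continuous fun A : SU2 => (A.1 1 0).re := Complex.continuous_re.comp (continuous_entry 1 0)
  have h4 : Continuous fun A : SU2 => (A.1 1 0).im := Complex.continuous_im.comp (continuous_entry 1 0)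
  refine Continuous.subtype_mk (continuous_matrix fun i j => ?_) _
  fin_cases i <;> fin_cases j <;> simp <;> fun_prop

theorem lastColumn_doubleCover (A : SU2) : lastColumn (doubleCover A) = hopf A := by
  apply S2.ext' <;> simp [lastColumn, hopf, S2.mk, doubleCover, Complex.normSq_apply] <;> ring

/-- The double cover `U(1) → SO(2)` corresponding to `doubleCover`. -/
def circleToSO2 : Circle →* SO2 where
  -- In the Pauli basis `x + i y` is the lower left matrix entry, which conjugation by `diag(z, z̄)`
  -- multiplies by `z̄²`. Hence a rotation by minus twice the argument of `z`.
  toFun z := ⟨!![((z : ℂ) ^ 2).re, ((z : ℂ) ^ 2).im; -((z : ℂ) ^ 2).im, ((z : ℂ) ^ 2).re], by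
    have h : Complex.normSq ((z : ℂ) ^ 2) = 1 := by simp
    rw [Complex.normSq_apply] at h
    rw [Matrix.of_mem_specialOrthogonalGroup_fin_two_iff]
    exact ⟨rfl, by ring, by linarith⟩⟩
  map_one' := by
    apply Subtype.ext
    ext i j
    fin_cases i <;> fin_cases j <;> simp
  map_mul' z w := by
    apply Subtype.ext
    ext i j
    fin_cases i <;> fin_cases j <;> simp [mul_pow] <;> ring

theorem continuous_circleToSO2 : Continuous circleToSO2 := by
  refine Continuous.subtype_mk (continuous_matrix fun i j => ?_) _
  have h : Continuous fun z : Circle => (z : ℂ) ^ 2 := by fun_prop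
  have hr := Complex.continuous_re.comp h
  have hi := Complex.continuous_im.comp h
  fin_cases i <;> fin_cases j
  exacts [hr, hi, hi.neg, hr]

theorem doubleCover_mul (A : SU2) (z : Circle) :
    doubleCover (A * circleToSU2 z) = doubleCover A * SO2ToSO3 (circleToSO2 z) := by
  have hz : Complex.normSq (z : ℂ) = 1 := by simp
  rw [Complex.normSq_apply] at hz
  refine SO3.ext_entries fun i j => ?_
  fin_cases i <;> fin_cases j <;>
    simp [doubleCover, circleToSU2, SO2ToSO3, circleToSO2, Matrix.mul_apply, pow_two] <;> grind

theorem doubleCover_star (z : Circle) (A : SU2) :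
    doubleCover (SU2modU1.star z A) = SO3modSO2.star (circleToSO2 z) (doubleCover A) := by
  rw [SU2modU1, SO3modSO2, Biquotient.homogeneous_star, Biquotient.homogeneous_star, ← map_inv,
    doubleCover_mul, map_inv, map_inv]

/-- The frame is pulled back along `doubleCover` and the representation along `circleToSO2`;
`doubleCover_star` keeps them compatible. -/
theorem biquotientBundles_SO3_subset_SU2 (𝕜 : Type) [RCLike 𝕜] :
    biquotientBundles 𝕜 SO3modSO2 SO3modSO2.homeo ⊆
      biquotientBundles 𝕜 SU2modU1 SU2modU1.homeo := by
  intro E hE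
  obtain ⟨n, ρ, hρ, F, hF, hequiv⟩ := exists_frame_of_mem_biquotientBundles _ _ hE
  change ∀ A : SO3, (Fin n → 𝕜) ≃ₗ[𝕜] E.Fiber (lastColumn A) at F
  change E.IsFrame lastColumn F Set.univ at hF
  change ∀ h A v, E.pt (lastColumn (SO3modSO2.star h A)) (F (SO3modSO2.star h A) (ρ h v)) =
    E.pt (lastColumn A) (F A v) at hequiv
  choose K hK using fun A : SU2 => E.exists_equiv_of_eq (lastColumn_doubleCover A)
  refine mem_biquotientBundles_of_frame _ _ (ρ.comp circleToSO2) ?_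
    (fun A => (F (doubleCover A)).trans (K A)) (fun v => ?_) (fun z A v => ?_)
  · exact hρ.comp ((continuous_circleToSO2.comp continuous_fst).prodMk continuous_snd)
  · change ContinuousOn (fun A => E.pt (hopf A) (K A (F (doubleCover A) v))) _
    simp only [hK]
    exact ((hF v).comp_continuous continuous_doubleCover fun _ => Set.mem_univ _).continuousOn
  · change E.pt (hopf (SU2modU1.star z A)) (K _ (F (doubleCover _) (ρ (circleToSO2 z) v))) =
      E.pt (hopf A) (K A (F (doubleCover A) v))
    rw [hK, hK, doubleCover_star, hequiv]

/-! ### The Hopf line bundle -/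

theorem normSq_planar (x : S2) : Complex.normSq (planar x) = 1 - x.1 2 ^ 2 := by
  have := x.sq_sum
  simp [planar, Complex.normSq_apply]
  linarith

theorem planar_ne_zero_iff (x : S2) : planar x ≠ 0 ↔ x.1 2 ≠ -1 ∧ x.1 2 ≠ 1 := by
  rw [← Complex.normSq_pos, normSq_planar]
  have h : 0 ≤ 1 - x.1 2 ^ 2 := normSq_planar x ▸ Complex.normSq_nonneg _
  rw [h.lt_iff_ne', Ne, ← not_or, not_iff_not]
  constructor
  · intro h
    have : (x.1 2 + 1) * (x.1 2 - 1) = 0 := by linarith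
    rcases mul_eq_zero.1 this with h | h
    · exact Or.inl (by linarith)
    · exact Or.inr (by linarith)
  · rintro (h | h) <;> rw [h] <;> norm_num

theorem planar_hopf (A : SU2) : planar (hopf A) = 2 * (star (A.1 0 0) * A.1 1 0) := by
  apply Complex.ext <;> simp [planar, hopf, S2.mk]

theorem hopf_two (A : SU2) : (hopf A).1 2 = Complex.normSq (A.1 0 0) - Complex.normSq (A.1 1 0) := by
  simp [hopf, S2.mk]

theorem normSq_add_normSq (A : SU2) :
    Complex.normSq (A.1 0 0) + Complex.normSq (A.1 1 0) = 1 := by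
  have := A.entries.2.2
  rw [Complex.normSq_apply, Complex.normSq_apply]
  linarith

/-- Charts of the Hopf line bundle: the complements of the south pole and of the north pole. -/
def chart : Bool → Set S2
  | true => {x | x.1 2 ≠ -1}
  | false => {x | x.1 2 ≠ 1}

theorem isOpen_chart (i : Bool) : IsOpen (chart i) := by
  cases i
  · exact isOpen_ne_fun (continuous_coord 2) continuous_const
  · exact isOpen_ne_fun (continuous_coord 2) continuous_const

/-- The preferred chart at a point. -/
def chartAt (x : S2) : Bool := by
  classical exact decide (0 ≤ x.1 2)

theorem chartAt_eq_true {x : S2} : chartAt x = true ↔ 0 ≤ x.1 2 := by simp [chartAt]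

theorem chartAt_eq_false {x : S2} : chartAt x = false ↔ x.1 2 < 0 := by simp [chartAt]

theorem mem_chart_chartAt (x : S2) : x ∈ chart (chartAt x) := by
  by_cases h : 0 ≤ x.1 2
  · rw [chartAt_eq_true.2 h]
    exact fun h' => by linarith
  · rw [chartAt_eq_false.2 (not_le.1 h)]
    exact fun h' => by linarith

theorem upper_subset_chart : upper ⊆ chart true := fun x (hx : 0 ≤ x.1 2) h => by linarith

theorem lower_subset_chart : lower ⊆ chart false := fun x (hx : x.1 2 ≤ 0) h => by linarith

/-- `planar x` as a unit, with the value `1` at the poles. -/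
def planarUnit (x : S2) : ℂˣ := by
  classical exact if h : planar x = 0 then 1 else Units.mk0 _ h

theorem planarUnit_val {x : S2} (h : planar x ≠ 0) : (planarUnit x : ℂ) = planar x := by
  simp [planarUnit, h]

/-- The function relating the chart `i` to the chart `true`. -/
def chartUnit (i : Bool) (x : S2) : ℂˣ := if i then 1 else planarUnit x

/-- Multiplication by a unit. -/
def mulUnit (𝕜 : Type) [RCLike 𝕜] [NormedAlgebra 𝕜 ℂ] (u : ℂˣ) : ℂ ≃ₗ[𝕜] ℂ :=
  { LinearMap.mulLeft 𝕜 (u : ℂ) with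
    invFun := fun c => (u⁻¹ : ℂˣ) * c
    left_inv := fun c => by simp
    right_inv := fun c => by simp }

theorem mulUnit_apply (𝕜 : Type) [RCLike 𝕜] [NormedAlgebra 𝕜 ℂ] (u : ℂˣ) (c : ℂ) :
    mulUnit 𝕜 u c = u * c := rfl

section Line

variable {𝕜 : Type} [RCLike 𝕜] [NormedAlgebra 𝕜 ℂ] {n : ℕ} (N : ℂ ≃L[𝕜] (Fin n → 𝕜))

/-- Multiplication by the conjugate of `z`, transported to `𝕜ⁿ`. -/
def conjMul (z : ℂ) : (Fin n → 𝕜) →L[𝕜] (Fin n → 𝕜) :=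
  (N : ℂ →L[𝕜] (Fin n → 𝕜)) ∘L ContinuousLinearMap.mul 𝕜 ℂ (star z) ∘L
    (N.symm : (Fin n → 𝕜) →L[𝕜] ℂ)

theorem conjMul_apply (z : ℂ) (v : Fin n → 𝕜) : conjMul N z v = N (star z * N.symm v) := rfl

theorem continuous_conjMul : Continuous (conjMul N) := by
  have h : Continuous fun z : ℂ => ContinuousLinearMap.mul 𝕜 ℂ (star z) :=
    (ContinuousLinearMap.mul 𝕜 ℂ).continuous.comp continuous_star
  exact continuous_const.clm_comp (h.clm_comp continuous_const)

/-- The gluing data of the Hopf line bundle, with fiber `𝕜ⁿ ≃ ℂ`. -/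
def lineCore : VectorBundleCore 𝕜 S2 (Fin n → 𝕜) Bool where
  baseSet := chart
  isOpen_baseSet := isOpen_chart
  indexAt := chartAt
  mem_baseSet_at := mem_chart_chartAt
  -- From `true` to `false` this multiplies coordinates by the conjugate of `planar`. On the unit
  -- circle the conjugate is the inverse, so the frames themselves are related by `planar`.
  coordChange i j x := conjMul N ((chartUnit j x / chartUnit i x : ℂˣ) : ℂ)
  coordChange_self i x _ v := by simp [conjMul_apply]
  continuousOn_coordChange i j := by
    refine (continuous_conjMul N).comp_continuousOn ?_
    have h {x : S2} (h1 : x ∈ chart true) (h2 : x ∈ chart false) : planar x ≠ 0 :=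
      (planar_ne_zero_iff x).2 ⟨h1, h2⟩
    cases i <;> cases j
    · simpa [chartUnit] using continuousOn_const
    · refine (continuous_planar.continuousOn.inv₀ fun x hx => h hx.2 hx.1).congr fun x hx => ?_
      simp [chartUnit, planarUnit_val (h hx.2 hx.1)]
    · refine continuous_planar.continuousOn.congr fun x hx => ?_
      simp [chartUnit, planarUnit_val (h hx.1 hx.2)]
    · simpa [chartUnit] using continuousOn_const
  coordChange_comp i j k x _ v := by
    simp only [conjMul_apply, ContinuousLinearEquiv.symm_apply_apply, ← mul_assoc, ← star_mul',
      ← Units.val_mul]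
    simp

/-- The Hopf line bundle, as a `𝕜`-vector bundle with fiber `𝕜ⁿ ≃ ℂ`. -/
def line : VecBundle 𝕜 S2 where
  rank := n
  Fiber := (lineCore N).Fiber

/-- The identification of the fiber model with a fiber of the Hopf line bundle. -/
def lineFiber (x : S2) : ℂ ≃ₗ[𝕜] (line N).Fiber x := N.toLinearEquiv

theorem line_pt_eq {x y : S2} (h : x = y) {c d : ℂ} (hcd : c = d) :
    (line N).pt x (lineFiber N x c) = (line N).pt y (lineFiber N y d) := by
  subst h hcd
  rfl

/-- A section of the Hopf line bundle is continuous if its local expressions in the charts are. -/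
theorem continuousOn_line {X : Type*} [TopologicalSpace X] {p : X → S2} {D : Set X} {s : X → ℂ}
    (κ : Bool → X → ℂ) (hp : ContinuousOn p D)
    (hs : ∀ x ∈ D, s x = κ (chartAt (p x)) x)
    (hκ : ∀ i, ContinuousOn (κ i) (D ∩ p ⁻¹' chart i))
    (h : ∀ x ∈ D, planar (p x) ≠ 0 → κ false x = star (planar (p x)) * κ true x) :
    ContinuousOn (fun x => (line N).pt (p x) (lineFiber N (p x) (s x))) D := by
  intro x₀ hx₀
  refine (line N).continuousWithinAt_pt.2 ⟨hp x₀ hx₀, ?_⟩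
  let j := chartAt (p x₀)
  have hj : ∀ᶠ x in 𝓝[D] x₀, x ∈ D ∩ p ⁻¹' chart j :=
    Filter.Eventually.and self_mem_nhdsWithin
      ((hp x₀ hx₀).eventually ((isOpen_chart j).mem_nhds (mem_chart_chartAt _)))
  have key : ∀ x ∈ D ∩ p ⁻¹' chart j,
      (line N).coord (p x₀) (p x) (lineFiber N (p x) (s x)) = N (κ j x) := by
    rintro x ⟨hx, hxj⟩
    have h1 : (line N).coord (p x₀) (p x) (lineFiber N (p x) (s x)) =
        (lineCore N).coordChange (chartAt (p x)) j (p x) (N (s x)) := by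
      change ((lineCore N).localTriv j).linearMapAt 𝕜 (p x) (N (s x)) = _
      rw [Trivialization.coe_linearMapAt_of_mem _ hxj]
      rfl
    rw [h1]
    change conjMul N _ (N (s x)) = _
    rw [conjMul_apply, N.symm_apply_apply, hs x hx]
    congr 1
    have hi := mem_chart_chartAt (p x)
    have hn {i : Bool} (h1 : p x ∈ chart i) (h2 : p x ∈ chart !i) : planar (p x) ≠ 0 := by
      cases i
      exacts [(planar_ne_zero_iff _).2 ⟨h2, h1⟩, (planar_ne_zero_iff _).2 ⟨h1, h2⟩]
    generalize chartAt (p x) = i at *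
    change p x ∈ chart j at hxj
    generalize j = j at *
    cases i <;> cases j
    · simp [chartUnit]
    · have h0 := hn hi hxj
      rw [h x hx h0]
      simp [chartUnit, planarUnit_val h0, h0]
    · have h0 := hn hi hxj
      rw [h x hx h0]
      simp [chartUnit, planarUnit_val h0]
    · simp [chartUnit]
  have hmem : x₀ ∈ D ∩ p ⁻¹' chart j := ⟨hx₀, mem_chart_chartAt _⟩
  refine ContinuousWithinAt.congr_of_eventuallyEq (f := fun x => N (κ j x)) ?_ ?_ (key _ hmem)
  · refine N.continuous.continuousAt.comp_continuousWithinAt ?_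
    exact (hκ j x₀ hmem).mono_of_mem_nhdsWithin hj
  · filter_upwards [hj] with x hx using key x hx

/-- The frame of the Hopf line bundle given by the chart `i`. -/
def lineFrame (i : Bool) (x : S2) : ℂ ≃ₗ[𝕜] (line N).Fiber x :=
  (mulUnit 𝕜 (star (chartUnit (chartAt x) x / chartUnit i x))).trans (lineFiber N x)

/-- The frame is constant in chart `i`; the factor in `lineFrame` only rewrites it in the preferred
chart, in which fibers are stored. -/
theorem isFrame_lineFrame (i : Bool) : (line N).IsFrame id (lineFrame N i) (chart i) := by
  intro c
  have hc : Continuous fun x => star (planar x) := continuous_planar.star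
  have hn {x : S2} {i : Bool} (h1 : x ∈ chart i) (h2 : x ∈ chart !i) : planar x ≠ 0 := by
    cases i
    exacts [(planar_ne_zero_iff _).2 ⟨h2, h1⟩, (planar_ne_zero_iff _).2 ⟨h1, h2⟩]
  cases i
  · refine continuousOn_line N (fun j x => if j then (star (planar x))⁻¹ * c else c)
      continuousOn_id (fun x hx => ?_) (fun j => ?_) (fun x _ h => ?_)
    · have key : ∀ i, x ∈ chart i → mulUnit 𝕜 (star (chartUnit i x / chartUnit false x)) c =
          if i then (star (planar x))⁻¹ * c else c := by
        rintro (_ | _) hi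
        · simp [chartUnit, mulUnit_apply]
        · simp [chartUnit, mulUnit_apply, planarUnit_val (hn hx hi)]
      exact key _ (mem_chart_chartAt x)
    · cases j
      · simpa using continuousOn_const
      · simp only [if_true]
        exact (hc.continuousOn.inv₀ fun x hx => by
          simpa using hn (i := false) hx.1 hx.2).mul continuousOn_const
    · have h' : star (planar x) ≠ 0 := by simpa using h
      exact (mul_inv_cancel_left₀ h' c).symm
  · refine continuousOn_line N (fun j x => if j then c else star (planar x) * c)
      continuousOn_id (fun x hx => ?_) (fun j => ?_) (fun x _ h => ?_)
    · have key : ∀ i, x ∈ chart i → mulUnit 𝕜 (star (chartUnit i x / chartUnit true x)) c =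
          if i then c else star (planar x) * c := by
        rintro (_ | _) hi
        · simp [chartUnit, mulUnit_apply, planarUnit_val (hn hx hi)]
        · simp [chartUnit, mulUnit_apply]
      exact key _ (mem_chart_chartAt x)
    · cases j
      · exact (hc.mul continuous_const).continuousOn
      · simpa using continuousOn_const
    · simp

theorem lineFrame_false {x : S2} (hx : x.1 2 = 0) (c : ℂ) :
    lineFrame N false x c = lineFrame N true x (planar x * c) := by
  have h1 : Complex.normSq (planar x) = 1 := by rw [normSq_planar, hx]; norm_num
  have h0 : planar x ≠ 0 := fun h => by simp [h] at h1
  have h2 : star (planar x) * planar x = 1 := by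
    rw [mul_comm]
    exact (Complex.mul_conj _).trans (by simp [h1])
  change lineFiber N x (_ * c) = lineFiber N x (_ * (planar x * c))
  congr 1
  have h3 : (star (planar x))⁻¹ = planar x := inv_eq_of_mul_eq_one_right h2
  rw [← mul_assoc]
  congr 1
  have h4 : ((star (chartUnit (chartAt x) x / chartUnit false x) : ℂˣ) : ℂ) =
      star ((chartUnit (chartAt x) x : ℂˣ) : ℂ) * (star (planar x))⁻¹ := by
    simp only [div_eq_mul_inv, star_mul', Units.val_mul, Units.coe_star, Units.val_inv_eq_inv_val,
      chartUnit, Bool.false_eq_true, if_false, planarUnit_val h0, star_inv₀]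
  rw [h4, h3]
  simp [chartUnit]

theorem isClutched_line : IsClutched (line N) :=
  ⟨lineFrame N true, lineFrame N false, (isFrame_lineFrame N true).mono upper_subset_chart,
    (isFrame_lineFrame N false).mono lower_subset_chart, fun _ hx c => lineFrame_false N hx c⟩

/-- The representation of the circle by multiplication by the conjugate. -/
def conjRep : Representation 𝕜 Circle (Fin n → 𝕜) where
  toFun z := (conjMul N z).toLinearMap
  map_one' := by
    refine LinearMap.ext fun v => ?_
    simp [conjMul_apply]
  map_mul' z w := by
    refine LinearMap.ext fun v => ?_
    simp [conjMul_apply, mul_assoc]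

/-- The local expressions of the tautological section over `SU(2)`. -/
def tautCoord (i : Bool) (A : SU2) : ℂ := if i then (2 * A.1 0 0)⁻¹ else star (A.1 1 0)

theorem tautCoord_ne_zero (A : SU2) : tautCoord (chartAt (hopf A)) A ≠ 0 := by
  have h1 := hopf_two A
  have h2 := normSq_add_normSq A
  by_cases h : 0 ≤ (hopf A).1 2
  · rw [chartAt_eq_true.2 h]
    have : A.1 0 0 ≠ 0 := fun h0 => by simp only [h0, map_zero] at h1 h2; linarith
    simpa [tautCoord] using this
  · rw [chartAt_eq_false.2 (not_le.1 h)]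
    have : A.1 1 0 ≠ 0 := fun h0 => by simp only [h0, map_zero] at h1 h2; linarith
    simpa [tautCoord] using this

/-- The nowhere zero section over `SU(2)` is `1 / (2a)` in one chart and `b̄` in the other, where
`(a, b)` is the first column. These match because `planar` of the Hopf image is `2 ā b`. Acting by
`z` replaces `(a, b)` by `(a z̄, b z̄)` and multiplies the section by `z`, which `conjRep`
compensates. -/
theorem line_mem_biquotientBundles :
    line N ∈ biquotientBundles 𝕜 SU2modU1 SU2modU1.homeo := by
  refine mem_biquotientBundles_of_frame _ _ (conjRep N) ?_
    (fun A => N.symm.toLinearEquiv.trans ((mulUnit 𝕜 (Units.mk0 _ (tautCoord_ne_zero A))).trans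
      (lineFiber N (hopf A)))) (fun v => ?_) (fun z A v => ?_)
  · change Continuous fun p : Circle × (Fin n → 𝕜) => N (star (p.1 : ℂ) * N.symm p.2)
    exact N.continuous.comp (((continuous_subtype_val.comp continuous_fst).star).mul
      (N.symm.continuous.comp continuous_snd))
  · refine continuousOn_line N (p := hopf) (fun i A => tautCoord i A * N.symm v)
      continuous_hopf.continuousOn (fun A _ => rfl) (fun i => ?_) (fun A _ h => ?_)
    · refine ContinuousOn.mul ?_ continuousOn_const
      cases i
      · exact (continuous_entry 1 0).star.continuousOn
      · refine (continuous_const.mul (continuous_entry 0 0)).continuousOn.inv₀ ?_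
        rintro A ⟨-, hA⟩ h0
        have h0' : A.1 0 0 = 0 := by simpa using h0
        have h1 := hopf_two A
        have h2 := normSq_add_normSq A
        simp only [h0', map_zero] at h1 h2
        exact hA (by linarith)
    · rw [planar_hopf] at h ⊢
      have ha : A.1 0 0 ≠ 0 := fun h0 => h (by simp [h0])
      simp [tautCoord]
      field_simp
  · refine line_pt_eq N ((hopf_eq_iff _ _).2 ⟨z, rfl⟩).symm ?_
    have hst : SU2modU1.star z A = A * circleToSU2 z⁻¹ := by
      rw [SU2modU1, Biquotient.homogeneous_star, map_inv]
    have hz : (z : ℂ) * star (z : ℂ) = 1 := by simp [Complex.mul_conj]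
    have hz' : star (z : ℂ) ≠ 0 := right_ne_zero_of_mul_eq_one hz
    have hp : hopf (SU2modU1.star z A) = hopf A := ((hopf_eq_iff _ _).2 ⟨z, rfl⟩).symm
    have hk (i : Bool) : tautCoord i (SU2modU1.star z A) * star (z : ℂ) = tautCoord i A := by
      cases i
      · have h1 : (A * circleToSU2 z⁻¹).1 1 0 = A.1 1 0 * star (z : ℂ) := by
          simp [circleToSU2, Matrix.mul_apply]
          exact Or.inl (inv_eq_of_mul_eq_one_right hz)
        rw [hst]
        simp only [tautCoord, Bool.false_eq_true, if_false, h1, star_mul', star_star]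
        linear_combination star (A.1 1 0) * hz
      · have h1 : (A * circleToSU2 z⁻¹).1 0 0 = A.1 0 0 * star (z : ℂ) := by
          simp [circleToSU2, Matrix.mul_apply]
          exact Or.inl (inv_eq_of_mul_eq_one_right hz)
        rw [hst]
        simp only [tautCoord, if_true, h1, mul_inv, mul_assoc, inv_mul_cancel₀ hz', mul_one]
    change tautCoord (chartAt (hopf (SU2modU1.star z A))) (SU2modU1.star z A) *
      N.symm (conjMul N z v) = tautCoord (chartAt (hopf A)) A * N.symm v
    rw [conjMul_apply, N.symm_apply_apply, ← mul_assoc, hp, hk]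

end Line

/-! ### Euler numbers and clutching -/

theorem planar_equator (t : ℝ) : planar (equator t) = Complex.exp (t * Complex.I) := by
  rw [Complex.exp_mul_I]
  simp [planar, equator, S2.mk]

theorem equator_two (t : ℝ) : (equator t).1 2 = 0 := by simp [equator, S2.mk]

theorem equator_add_two_pi (t : ℝ) : equator (t + 2 * Real.pi) = equator t := by
  simp [equator]

theorem equator_arg {x : S2} (hx : x.1 2 = 0) : equator (planar x).arg = x := by
  have h1 : ‖planar x‖ = 1 := by
    have := normSq_planar x
    rw [hx, Complex.normSq_eq_norm_sq] at this
    nlinarith [norm_nonneg (planar x)]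
  have h2 : planar x = Complex.exp ((planar x).arg * Complex.I) := by
    have := Complex.norm_mul_exp_arg_mul_I (planar x)
    rw [h1] at this
    simpa using this.symm
  rw [← planar_equator] at h2
  apply S2.ext'
  · simpa [planar] using congrArg Complex.re h2.symm
  · simpa [planar] using congrArg Complex.im h2.symm
  · rw [equator_two, hx]

theorem isClosed_equator : IsClosed {x : S2 | x.1 2 = 0} :=
  isClosed_eq (continuous_coord 2) continuous_const

theorem planar_ne_zero {x : S2} (hx : x.1 2 = 0) : planar x ≠ 0 :=
  (planar_ne_zero_iff x).2 ⟨by rw [hx]; norm_num, by rw [hx]; norm_num⟩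

/-- Tietze's theorem. It turns corrections known only on the equator into changes of frame over the
hemispheres. -/
theorem exists_extension_real {f : S2 → ℝ} (hf : ContinuousOn f {x | x.1 2 = 0}) :
    ∃ g : S2 → ℝ, Continuous g ∧ ∀ x, x.1 2 = 0 → g x = f x := by
  obtain ⟨g, hg⟩ := ContinuousMap.exists_restrict_eq isClosed_equator
    ⟨_, continuousOn_iff_continuous_domRestrict.1 hf⟩
  exact ⟨g, g.continuous, fun x hx => congrArg (fun k => k ⟨x, hx⟩) hg⟩

/-- A nowhere zero function on the equator with winding number `n` is the product of the `n`-th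
power of the standard function and of the exponential of a function that extends to the sphere. -/
theorem HasWindingNumber.exists_log {c : S2 → ℂ} {n : ℤ}
    (h : HasWindingNumber (fun t => c (equator t)) n) :
    ∃ φ : S2 → ℂ, Continuous φ ∧ ∀ x, x.1 2 = 0 → c x = Complex.exp (φ x) * planar x ^ n := by
  obtain ⟨θ, hθ, hc, hper⟩ := h
  -- Removing the linear growth makes the logarithm periodic, so that it descends to the circle.
  let ψ (t : ℝ) : ℂ := θ t - n * t * Complex.I
  have hψ : Continuous ψ := by fun_prop
  have hcψ (t : ℝ) : c (equator t) = Complex.exp (ψ t) * planar (equator t) ^ n := by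
    rw [planar_equator, ← Complex.exp_int_mul, ← Complex.exp_add]
    refine (hc t).trans ?_
    congr 1
    simp only [ψ]
    ring
  have hexp (t : ℝ) : Complex.exp (ψ (t + 2 * Real.pi)) = Complex.exp (ψ t) := by
    have h1 := hcψ (t + 2 * Real.pi)
    rw [equator_add_two_pi, hcψ t] at h1
    exact (mul_right_cancel₀ (zpow_ne_zero _ (planar_ne_zero (equator_two t))) h1).symm
  have hψper : Function.Periodic ψ (2 * Real.pi) := by
    intro t
    have h1 := sub_eq_sub_of_exp_eq (g := fun t => ψ (t + 2 * Real.pi)) (h := ψ) (by fun_prop) hψ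
      hexp t 0
    have h2 : ψ (0 + 2 * Real.pi) - ψ 0 = 0 := by
      simp only [ψ, zero_add, hper]
      push_cast
      ring
    rw [h2] at h1
    exact sub_eq_zero.1 h1
  let χ : Real.Angle → ℂ := hψper.lift
  have hχ : Continuous χ := continuous_coinduced_dom.2 hψ
  -- The argument is taken modulo `2π`, where it is continuous away from zero.
  let φ (x : S2) : ℂ := χ ((planar x).arg : Real.Angle)
  have hφ : ContinuousOn φ {x | x.1 2 = 0} := fun x hx =>
    (hχ.continuousAt.comp ((Complex.continuousAt_arg_coe_angle (planar_ne_zero hx)).comp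
      continuous_planar.continuousAt)).continuousWithinAt
  have hφc (x : S2) (hx : x.1 2 = 0) : c x = Complex.exp (φ x) * planar x ^ n := by
    have := hcψ (planar x).arg
    rw [equator_arg hx] at this
    exact this
  obtain ⟨f, hf, hf'⟩ := exists_extension_real (Complex.continuous_re.comp_continuousOn hφ)
  obtain ⟨g, hg, hg'⟩ := exists_extension_real (Complex.continuous_im.comp_continuousOn hφ)
  refine ⟨fun x => f x + g x * Complex.I, by fun_prop, fun x hx => ?_⟩
  simp only [hφc x hx, hf' x hx, hg' x hx, Function.comp_apply, Complex.re_add_im]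

/-- The real linear automorphism `1 ↦ 1`, `a + e^l I ↦ I` of `ℂ`. -/
def shear (a l : ℝ) : ℂ ≃ₗ[ℝ] ℂ where
  toFun c := ⟨c.re - a * (Real.exp (-l) * c.im), Real.exp (-l) * c.im⟩
  invFun c := ⟨c.re + a * c.im, Real.exp l * c.im⟩
  map_add' c d := by apply Complex.ext <;> simp <;> ring
  map_smul' r c := by apply Complex.ext <;> simp <;> ring
  left_inv c := by
    apply Complex.ext <;> simp [← mul_assoc, ← Real.exp_add]
  right_inv c := by
    apply Complex.ext <;> simp [← mul_assoc, ← Real.exp_add]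

theorem map_eq_re_smul_add_im_smul {V : Type*} [AddCommGroup V] [Module ℝ V] (f : ℂ →ₗ[ℝ] V)
    (c : ℂ) : f c = c.re • f 1 + c.im • f Complex.I := by
  rw [← map_smul, ← map_smul, ← map_add]
  congr 1
  simp

/-- Frames over the hemispheres whose transition function on the equator preserves the orientation
and has first column of winding number one can be normalized. -/
theorem isClutched_of_exp {E : VecBundle ℝ S2} {fU fL : ∀ x, ℂ ≃ₗ[ℝ] E.Fiber x}
    (hU : E.IsFrame id fU upper) (hL : E.IsFrame id fL lower) {φ : S2 → ℂ} (hφ : Continuous φ)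
    (h1 : ∀ x, x.1 2 = 0 → (fU x).symm (fL x 1) = Complex.exp (φ x) * planar x)
    (hI : ∀ x, x.1 2 = 0 →
      0 < (star ((fU x).symm (fL x 1)) * (fU x).symm (fL x Complex.I)).im) :
    IsClutched E := by
  let τ (c : ℂ) (x : S2) : ℂ := (fU x).symm (fL x c)
  have hτ (c : ℂ) : ContinuousOn (τ c) {x | x.1 2 = 0} :=
    (hU.mono fun x (hx : x.1 2 = 0) => hx.ge).continuousOn_coordinates
      ((hL c).mono fun x (hx : x.1 2 = 0) => hx.le)
  have hτ0 (x : S2) : τ 1 x ≠ 0 := by simp [τ]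
  -- The second column of the transition matrix relative to the first. Preservation of orientation
  -- puts it in the upper half plane, so it can be written `a + e^l i` and straightened to `i` by
  -- `shear`.
  let ζ (x : S2) : ℂ := τ Complex.I x / τ 1 x
  have hζ : ContinuousOn ζ {x | x.1 2 = 0} := (hτ _).div (hτ _) fun x _ => hτ0 x
  have hζpos (x : S2) (hx : x.1 2 = 0) : 0 < (ζ x).im := by
    have h := hI x hx
    change 0 < (star (τ 1 x) * τ Complex.I x).im at h
    have h2 : star (τ 1 x) * τ Complex.I x = (Complex.normSq (τ 1 x) : ℂ) * ζ x := by
      rw [← Complex.mul_conj, mul_comm (τ 1 x), mul_assoc, mul_div_cancel₀ _ (hτ0 x)]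
      rfl
    rw [h2, Complex.im_ofReal_mul] at h
    exact pos_of_mul_pos_right h (Complex.normSq_nonneg _)
  obtain ⟨a, ha, ha'⟩ := exists_extension_real (Complex.continuous_re.comp_continuousOn hζ)
  obtain ⟨l, hl, hl'⟩ := exists_extension_real
    ((Complex.continuous_im.comp_continuousOn hζ).log fun x hx => (hζpos x hx).ne')
  have hζal (x : S2) (hx : x.1 2 = 0) : (a x : ℂ) + (Real.exp (l x) : ℂ) * Complex.I = ζ x := by
    rw [ha' x hx, hl' x hx, Function.comp_apply, Function.comp_apply, Real.exp_log (hζpos x hx),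
      Complex.re_add_im]
  let u (x : S2) : ℂˣ := Units.mk0 _ (Complex.exp_ne_zero (φ x))
  -- The factor `exp φ` is absorbed in the upper frame and the shear in the lower one;
  -- multiplication by `planar` remains.
  refine ⟨fun x => (mulUnit ℝ (u x)).trans (fU x), fun x => (shear (a x) (l x)).trans (fL x),
    fun c => ?_, fun c => ?_, fun x hx c => ?_⟩
  · exact hU.continuousOn_apply (c := fun x => Complex.exp (φ x) * c)
      (by fun_prop : Continuous fun x => Complex.exp (φ x) * c).continuousOn
  · refine hL.continuousOn_apply (c := fun x => shear (a x) (l x) c) (Continuous.continuousOn ?_)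
    have h : Continuous fun x => ((c.re - a x * (Real.exp (-l x) * c.im) : ℝ) : ℂ) +
        ((Real.exp (-l x) * c.im : ℝ) : ℂ) * Complex.I := by fun_prop
    convert h using 2 with x
    rw [← Complex.mk_eq_add_mul_I]
    rfl
  · change fL x (shear (a x) (l x) c) = fU x (Complex.exp (φ x) * (planar x * c))
    rw [← LinearEquiv.symm_apply_eq, ← mul_assoc, ← h1 x hx]
    change τ (shear (a x) (l x) c) x = τ 1 x * c
    have h2 := map_eq_re_smul_add_im_smul ((fU x).symm.toLinearMap ∘ₗ (fL x).toLinearMap)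
      (shear (a x) (l x) c)
    change τ _ x = _ • τ 1 x + _ • τ Complex.I x at h2
    have h3 : τ Complex.I x = ζ x * τ 1 x := (div_mul_cancel₀ _ (hτ0 x)).symm
    rw [h2, h3, ← hζal x hx]
    have h4 : (Real.exp (-l x) : ℂ) * Real.exp (l x) = 1 := by
      rw [← Complex.ofReal_mul, ← Real.exp_add]
      simp
    have h5 : c = c.re + c.im * Complex.I := (Complex.re_add_im c).symm
    simp only [shear, LinearEquiv.coe_mk, LinearMap.coe_mk, AddHom.coe_mk, Complex.real_smul]
    push_cast at h4 ⊢
    conv_rhs => rw [h5]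
    linear_combination (τ 1 x * c.im * Complex.I) * h4

/-- The linear isomorphism from `ℂ` given by a basis with two elements. -/
def basisFrame {V : Type*} [AddCommGroup V] [Module ℝ V] (b : Module.Basis (Fin 2) ℝ V) :
    ℂ ≃ₗ[ℝ] V :=
  Complex.basisOneI.equivFun.trans b.equivFun.symm

section BasisFrame

variable {V : Type*} [AddCommGroup V] [Module ℝ V] (b : Module.Basis (Fin 2) ℝ V)

theorem basisFrame_apply (c : ℂ) : basisFrame b c = c.re • b 0 + c.im • b 1 := by
  simp [basisFrame, Module.Basis.equivFun_symm_apply, Fin.sum_univ_two]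

theorem basisFrame_symm_apply (v : V) :
    (basisFrame b).symm v = b.repr v 0 + b.repr v 1 * Complex.I := by
  simp [basisFrame]

theorem basisFrame_one : basisFrame b 1 = b 0 := by simp [basisFrame_apply]

theorem basisFrame_I : basisFrame b Complex.I = b 1 := by simp [basisFrame_apply]

theorem im_pos_of_orientation_eq {b' : Module.Basis (Fin 2) ℝ V}
    (h : b.orientation = b'.orientation) :
    0 < (star ((basisFrame b).symm (b' 0)) * (basisFrame b).symm (b' 1)).im := by
  have h' := (Module.Basis.orientation_eq_iff_det_pos _ _).1 h
  rw [Module.Basis.det_apply, Matrix.det_fin_two] at h'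
  simp only [Module.Basis.toMatrix_apply] at h'
  simp [basisFrame_symm_apply]
  linarith

end BasisFrame

theorem IsFrameOn.isFrame {E : VecBundle ℝ S2} {b : ∀ x, Module.Basis (Fin 2) ℝ (E.Fiber x)}
    {D : Set S2} (hb : IsFrameOn E b D) : E.IsFrame id (fun x => basisFrame (b x)) D := by
  intro c
  refine (E.continuousOn_smul_add_smul (hb 0) (hb 1) c.re c.im).congr fun x _ => ?_
  exact congrArg (E.pt x) (basisFrame_apply (b x) c)

/-- The winding number gives the first column of the transition matrix, the common orientation
controls the second, and `isClutched_of_exp` normalizes both. -/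
theorem HasEulerClassPMOne.isClutched {E : VecBundle ℝ S2} (hE : HasEulerClassPMOne E) :
    IsClutched E := by
  obtain ⟨-, o, -, h⟩ := hE
  have key {n : ℤ} (h : HasEulerNumber E o n) :
      ∃ fU fL : ∀ x, ℂ ≃ₗ[ℝ] E.Fiber x, E.IsFrame id fU upper ∧ E.IsFrame id fL lower ∧
        (∃ φ : S2 → ℂ, Continuous φ ∧
          ∀ x, x.1 2 = 0 → (fU x).symm (fL x 1) = Complex.exp (φ x) * planar x ^ n) ∧
        ∀ x, x.1 2 = 0 →
          0 < (star ((fU x).symm (fL x 1)) * (fU x).symm (fL x Complex.I)).im := by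
    obtain ⟨bU, bL, hU, hoU, hL, hoL, hw⟩ := h
    refine ⟨_, _, hU.isFrame, hL.isFrame, ?_, fun x hx => ?_⟩
    · refine HasWindingNumber.exists_log ?_
      convert hw using 2 with t
      rw [basisFrame_one, basisFrame_symm_apply]
    · rw [basisFrame_one, basisFrame_I]
      exact im_pos_of_orientation_eq _ ((hoU x hx.ge).trans (hoL x hx.le).symm)
  rcases h with h | h
  · obtain ⟨fU, fL, hU, hL, ⟨φ, hφ, h1⟩, hI⟩ := key h
    exact isClutched_of_exp hU hL hφ (fun x hx => by rw [h1 x hx, zpow_one]) hI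
  · obtain ⟨fU, fL, hU, hL, ⟨φ, hφ, h1⟩, hI⟩ := key h
    have happ (f : ∀ x, ℂ ≃ₗ[ℝ] E.Fiber x) (x : S2) (c : ℂ) :
        Complex.conjAe.toLinearEquiv.trans (f x) c = f x (star c) := rfl
    have hsymm (f : ∀ x, ℂ ≃ₗ[ℝ] E.Fiber x) (x : S2) (v : E.Fiber x) :
        (Complex.conjAe.toLinearEquiv.trans (f x)).symm v = star ((f x).symm v) := rfl
    -- For Euler number `-1` both frames are precomposed with complex conjugation: this turns
    -- `planar⁻¹` into `planar` on the unit circle, and the two reversals of orientation cancel.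
    refine isClutched_of_exp (fU := fun x => Complex.conjAe.toLinearEquiv.trans (fU x))
      (fL := fun x => Complex.conjAe.toLinearEquiv.trans (fL x)) (φ := fun x => star (φ x))
      (fun c => hU (star c)) (fun c => hL (star c)) hφ.star (fun x hx => ?_) (fun x hx => ?_)
    · have h2 : planar x * star (planar x) = 1 := by
        refine (Complex.mul_conj _).trans ?_
        rw [normSq_planar, hx]
        simp
      rw [happ, hsymm, star_one, h1 x hx, star_mul', zpow_neg_one, star_inv₀,
        inv_eq_of_mul_eq_one_left h2]
      congr 1
      exact (Complex.exp_conj _).symm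
    · have h2 := hI x hx
      have h3 : star Complex.I = -Complex.I := Complex.conj_I
      simp only [happ, hsymm, star_one, h3, map_neg, star_neg, star_star]
      simp at h2 ⊢
      linarith

theorem orientation_map_mulUnit (u : ℂˣ) :
    (Complex.basisOneI.map (mulUnit ℝ u)).orientation = Complex.basisOneI.orientation := by
  rw [eq_comm, Module.Basis.orientation_eq_iff_det_pos, Module.Basis.det_apply, Matrix.det_fin_two]
  have h := Complex.normSq_pos.2 u.ne_zero
  rw [Complex.normSq_apply] at h
  simpa [Module.Basis.toMatrix_apply, mulUnit_apply] using h

theorem orientation_map_mulUnit_trans {V : Type*} [AddCommGroup V] [Module ℝ V] (u : ℂˣ)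
    (g : ℂ ≃ₗ[ℝ] V) : (Complex.basisOneI.map ((mulUnit ℝ u).trans g)).orientation =
      (Complex.basisOneI.map g).orientation := by
  have h : Complex.basisOneI.map ((mulUnit ℝ u).trans g) =
      (Complex.basisOneI.map (mulUnit ℝ u)).map g := Module.Basis.eq_of_apply_eq fun i => by simp
  rw [h, Module.Basis.orientation_map, orientation_map_mulUnit, ← Module.Basis.orientation_map]

/-- The real Hopf bundle: its frames differ by complex multiplications, which preserve orientation,
and the lower frame read in the upper one is `exp (i t)` along the equator. -/
theorem exists_hasEulerClassPMOne : ∃ E : VecBundle ℝ S2, HasEulerClassPMOne E := by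
  let N : ℂ ≃L[ℝ] (Fin 2 → ℝ) := Complex.basisOneI.equivFunL
  let b (i : Bool) (x : S2) : Module.Basis (Fin 2) ℝ ((line N).Fiber x) :=
    Complex.basisOneI.map (lineFrame N i x)
  let o (x : S2) : Orientation ℝ ((line N).Fiber x) (Fin 2) :=
    (Complex.basisOneI.map (lineFiber N x)).orientation
  have ho (i : Bool) (x : S2) : (b i x).orientation = o x := orientation_map_mulUnit_trans _ _
  have hb (i : Bool) : IsFrameOn (line N) (b i) (chart i) := fun k =>
    isFrame_lineFrame N i (Complex.basisOneI k)
  refine ⟨line N, rfl, o, fun x => ⟨chart (chartAt x),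
    (isOpen_chart _).mem_nhds (mem_chart_chartAt x), b _, hb _, fun y _ => ho _ y⟩, Or.inl ?_⟩
  refine ⟨b true, b false, fun k => (hb true k).mono upper_subset_chart, fun x _ => ho _ x,
    fun k => (hb false k).mono lower_subset_chart, fun x _ => ho _ x,
    fun t => t * Complex.I, by fun_prop, fun t => ?_, by push_cast; ring⟩
  have h : (lineFrame N true (equator t)).symm (b false (equator t) 0) = planar (equator t) := by
    rw [LinearEquiv.symm_apply_eq]
    simp only [b, Module.Basis.map_apply]
    rw [lineFrame_false N (equator_two t)]
    simp
  rw [← planar_equator, ← h]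
  simp [b, Complex.re_add_im]

end Biq

end

/-! ### The main theorem -/

theorem mainTheorem11 :
    -- real and complex biquotient vector bundles: proper inclusion
    Biq.biquotientBundles ℝ Biq.SO3modSO2 Biq.SO3modSO2.homeo ⊂
      Biq.biquotientBundles ℝ Biq.SU2modU1 Biq.SU2modU1.homeo ∧
    Biq.biquotientBundles ℂ Biq.SO3modSO2 Biq.SO3modSO2.homeo ⊂
      Biq.biquotientBundles ℂ Biq.SU2modU1 Biq.SU2modU1.homeo ∧
    -- the rank-2 bundle with Euler class ±1 exists and is unique up to isomorphism
    (∃ E : Biq.VecBundle ℝ Biq.S2, Biq.HasEulerClassPMOne E) ∧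
    (∀ E E' : Biq.VecBundle ℝ Biq.S2,
      Biq.HasEulerClassPMOne E → Biq.HasEulerClassPMOne E' → E.IsIso E') ∧
    -- it arises from the presentation SU(2)/U(1), but not from SO(3)/SO(2)
    (∀ E : Biq.VecBundle ℝ Biq.S2, Biq.HasEulerClassPMOne E →
      E ∈ Biq.biquotientBundles ℝ Biq.SU2modU1 Biq.SU2modU1.homeo ∧
      E ∉ Biq.biquotientBundles ℝ Biq.SO3modSO2 Biq.SO3modSO2.homeo) := by
  -- The same Hopf bundle witnesses strictness twice: as a real bundle of rank 2 and as a complex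
  -- bundle of rank 1.
  let NR : ℂ ≃L[ℝ] (Fin 2 → ℝ) := Complex.basisOneI.equivFunL
  let NC : ℂ ≃L[ℂ] (Fin 1 → ℂ) := (ContinuousLinearEquiv.funUnique (Fin 1) ℂ ℂ).symm
  refine ⟨?_, ?_, Biq.exists_hasEulerClassPMOne, fun E E' hE hE' =>
    hE.isClutched.isIso hE'.isClutched, fun E hE => ⟨?_, hE.isClutched.notMem_biquotientBundles⟩⟩
  · exact Set.ssubset_iff_subset_ne.2 ⟨Biq.biquotientBundles_SO3_subset_SU2 ℝ, fun h =>
      (Biq.isClutched_line NR).notMem_biquotientBundles (h ▸ Biq.line_mem_biquotientBundles NR)⟩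
  · exact Set.ssubset_iff_subset_ne.2 ⟨Biq.biquotientBundles_SO3_subset_SU2 ℂ, fun h =>
      (Biq.isClutched_line NC).notMem_biquotientBundles (h ▸ Biq.line_mem_biquotientBundles NC)⟩
  · exact Biq.mem_biquotientBundles_of_isIso _ _
      ((Biq.isClutched_line NR).isIso hE.isClutched) (Biq.line_mem_biquotientBundles NR)
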